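/- Let $\Lambda=2\omega_1\mathbb Z+2\omega_3\mathbb Z$ with $2\omega_1$ a nonzero real number and $2\omega_3$ a nonzero purely imaginary number, let $\sigma(u)=u\prod_{s\in\Lambda\setminus\{0\}}\left(1-\frac us\right)e^{u/s+u^2/(2s^2)}$ be its Weierstrass sigma function, and let $w$ be real with $wN_1\neq\omega_1N_2$ for all integers $(N_1,N_2)\ne(0,0)$. Put $[x]=\sigma(wx)/\sigma(w)$, $[x]_n=[x][x+1]\cdots[x+n-1]$, $[n]!=[1]_n$. Let $\alpha,\beta,\gamma\in\mathbb C$ with $\beta\notin\Lambda$ and $\alpha+mw\notin\Lambda$ for all $m\in\mathbb Z$, and put $\hat\alpha=\alpha/w$, $\hat\beta=\beta/w$. Consider the elliptic moments $$c_n=c_n(\alpha)=e^{\gamma wn+\gamma\alpha}\,\frac{\sigma(wn+\beta+\alpha)}{\sigma(wn+\alpha)\,\sigma(\beta)}\qquad(n\in\mathbb Z),$$ the Toeplitz determinants $\Delta_n^{(j)}=\det(c_{j+k-i})_{0\le i,k<n}$ ($\Delta^{(j)}_0=1$, $\Delta_n=\Delta_n^{(0)}$), the quotients $h_n^{(j)}=\Delta_{n+1}^{(j)}/\Delta_n^{(j)}$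 ($h_n=h_n^{(0)}$), and the monic Laurent biorthogonal polynomials $P_n(z)$, where $\Delta_nP_n(z)$ is the determinant with rows $(c_{-i},c_{1-i},\dots,c_{n-i})$ for $0\le i<n$ and last row $(1,z,\dots,z^n)$. **(0)** $\Delta_n^{(j)}(\alpha)=\Delta_n(\alpha+jw)$, and $\Delta^{(j)}_n\neq0$ if and only if $n(\alpha+jw)+\beta\notin\Lambda$ ($j\in\mathbb Z$, $n\ge0$). **(1)** Assume $\Delta_n\ne0$ and $\Delta_n^{(1)}\neq0$ for all $n$. Then for all $n\ge0$ $$h_n=\frac{e^{\gamma\alpha}}{\sigma(\alpha)}\frac{\sigma(\alpha(n+1)+\beta)}{\sigma(\alpha n+\beta)}\frac{[n]!^2}{[-\hat\alpha+1]_n[\hat\alpha+1]_n},\qquad h_n^{(1)}=\frac{e^{\gamma(\alpha+w)}}{\sigma(\alpha+w)}\frac{\sigma((\alpha+w)(n+1)+\beta)}{\sigma((\alpha+w)n+\beta)}\frac{[n]!^2}{[-\hat\alpha]_n[\hat\alpha+2]_n}.$$ The numbers $d_n=h_n^{(1)}/h_n=-P_{n+1}(0)/P_n(0)$ ($n\ge0$)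 and $b_n=d_nh_n/h_{n-1}$ ($n\ge1$), $b_0=0$, are $$d_n=e^{\gamma w}\frac{[\hat\alpha-n]\,[\hat\beta+(\hat\alpha+1)(n+1)]\,[\hat\beta+\hat\alpha n]}{[\hat\alpha+n+1]\,[\hat\beta+(\hat\alpha+1)n]\,[\hat\beta+\hat\alpha(n+1)]},\qquad b_n=-e^{\gamma w}\frac{[n]^2\,[\hat\beta+(\hat\alpha+1)(n+1)]\,[\hat\beta+\hat\alpha(n-1)]}{[\hat\beta+(\hat\alpha+1)n]\,[\hat\beta+\hat\alpha n]\,[\hat\alpha+n]\,[\hat\alpha+n+1]},$$ with $d_n\ne0$ for $n\ge0$ and $b_n\neq0$ for $n\ge1$. They are the unique complex numbers with $P_{n+1}+(d_n-z)P_n=z\,b_nP_{n-1}$ for $n\ge1$, and $d_0$ is the unique number with $P_1+(d_0-z)P_0=0$. **(2)** With $\alpha$ replaced by a complex variable $t$ in these formulas, $d_n(t)$ and $b_n(t)$ are elliptic functions of $t$ (meromorphic and $\Lambda$-periodic) for every $n\ge0$. **(3)** Assume $\Delta_n^{(j)}\ne0$ for all $n\ge0$, $j\in\mathbb Z$, and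 write $d_n^{(j)}=d_n(\alpha+jw)$, $b_n^{(j)}=b_n(\alpha+jw)$, and $P_n^{(j)}$ for the polynomial $P_n$ with $\alpha$ replaced by $\alpha+jw$. Then $d_n^{(j)}\neq0$, $b_0^{(j)}=0$, $b_{n}^{(j)}\ne0$ for $n\ge1$, and the two-point $QD$-algorithm holds for all $j$: $$b_n^{(j)}d_n^{(j+1)}=d_{n-1}^{(j)}b_n^{(j+1)}\ (n\ge1),\qquad b_n^{(j+1)}-d_n^{(j+1)}=b_{n+1}^{(j)}-d_n^{(j)}\ (n\ge0).$$ Equivalently, the discrete-time relativistic Toda chain holds: for $n\ge1$, $b_n^{(j)}\neq d_{n-1}^{(j)}$ and $$d_n^{(j+1)}=d_{n-1}^{(j)}\frac{b_{n+1}^{(j)}-d_n^{(j)}}{b_n^{(j)}-d_{n-1}^{(j)}},\qquad b_n^{(j+1)}=b_n^{(j)}\frac{b_{n+1}^{(j)}-d_n^{(j)}}{b_n^{(j)}-d_{n-1}^{(j)}},$$ and $d_0^{(j+1)}=d_0^{(j)}-b_1^{(j)}$. Moreover, put $e_n^{(j)}=b_n^{(j+n)}-d_n^{(j+n)}$ and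 $f_n^{(j)}=b_n^{(j+n-1)}$. Then $e_n^{(j)}\ne0$, $f_0^{(j)}=0$, $f_n^{(j)}\neq0$ for $n\ge1$, and the ordinary $QD$-algorithm holds for all $j$: $$e_{n-1}^{(j+1)}f_n^{(j+1)}=e_n^{(j)}f_n^{(j)}\ (n\ge1),\qquad e_n^{(j+1)}+f_n^{(j+1)}=e_n^{(j)}+f_{n+1}^{(j)}\ (n\ge0).$$ The polynomials $W_n^{(j)}(z)=P_n^{(j+n)}(z)$ satisfy $W_n^{(j-1)}=W_n^{(j)}-f_n^{(j)}W_{n-1}^{(j)}$ ($n\ge1$), $zW_n^{(j+1)}=W_{n+1}^{(j)}-e_n^{(j+1)}W_n^{(j)}$ ($n\ge0$), and $W_{n+1}^{(j)}-(e_n^{(j)}+f_{n+1}^{(j)})W_n^{(j)}+e_n^{(j)}f_n^{(j)}W_{n-1}^{(j)}=zW_n^{(j)}$ for $n\ge0$, where the $W_{n-1}^{(j)}$ term is absent for $n=0$. -/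

import Mathlib

namespace EllipticLBP

open Polynomial

noncomputable section

/-! ### Weierstrass sigma function and elliptic numbers -/

/-- The Weierstrass sigma function
`σ(u) = u ∏_{s ∈ Λ, s ≠ 0} (1 - u / s) exp (u / s + u² / (2 s²))`
of the lattice `Λ` of a period pair (an absolutely convergent product). -/
def sigma (L : PeriodPair) (u : ℂ) : ℂ :=
  u * ∏' s : {s : L.lattice // s ≠ 0},
    (1 - u / (s : ℂ)) * Complex.exp (u / (s : ℂ) + u ^ 2 / (2 * (s : ℂ) ^ 2))

/-- The elliptic number `[x] = σ(w x) / σ(w)`. -/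
def ellNum (L : PeriodPair) (w x : ℂ) : ℂ := sigma L (w * x) / sigma L w

/-- The elliptic Pochhammer symbol `[x]_n = [x] [x + 1] ⋯ [x + n - 1]`. -/
def ellPoch (L : PeriodPair) (w x : ℂ) (n : ℕ) : ℂ :=
  ∏ k ∈ Finset.range n, ellNum L w (x + k)

/-- The elliptic factorial `[n]! = [1] [2] ⋯ [n]`. -/
def ellFact (L : PeriodPair) (w : ℂ) (n : ℕ) : ℂ := ellPoch L w 1 n

/-- The elliptic moments
`c_n(t) = e^{γ w n + γ t} σ(w n + β + t) / (σ(w n + t) σ(β))`, `n ∈ ℤ`. -/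
def ellMoment (L : PeriodPair) (w β γ t : ℂ) (n : ℤ) : ℂ :=
  Complex.exp (γ * w * n + γ * t) *
    (sigma L (w * n + β + t) / (sigma L (w * n + t) * sigma L β))

/-! ### Laurent biorthogonal polynomials of a moment sequence `c : ℤ → ℂ` -/

/-- The Toeplitz determinant `Δ_n^{(j)}` of size `n`, with entries `c_{j + k - i}`
(row `i`, column `k`). In particular `Δ_0^{(j)} = 1`. -/
def toeplitz (c : ℤ → ℂ) (j : ℤ) (n : ℕ) : ℂ :=
  Matrix.det (Matrix.of fun i k : Fin n => c (j + ((k : ℕ) : ℤ) - ((i : ℕ) : ℤ)))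

/-- `h_n^{(j)} = Δ_{n+1}^{(j)} / Δ_n^{(j)}`; `h_n` is the case `j = 0`. -/
def hNorm (c : ℤ → ℂ) (j : ℤ) (n : ℕ) : ℂ := toeplitz c j (n + 1) / toeplitz c j n

/-- The monic Laurent biorthogonal polynomial `P_n(z)`: `Δ_n⁻¹` times the determinant whose
first `n` rows are `(c_{-i}, c_{1-i}, …, c_{n-i})`, `0 ≤ i < n`, and whose last row is
`(1, z, …, z^n)`. -/
def lbp (c : ℤ → ℂ) (n : ℕ) : ℂ[X] :=
  C (toeplitz c 0 n)⁻¹ *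
    Matrix.det (Matrix.of fun i k : Fin (n + 1) =>
      if (i : ℕ) < n then C (c (((k : ℕ) : ℤ) - ((i : ℕ) : ℤ))) else (X : ℂ[X]) ^ (k : ℕ))

/-- The recurrence coefficient `d_n = h_n^{(1)} / h_n`. -/
def recD (c : ℤ → ℂ) (n : ℕ) : ℂ := hNorm c 1 n / hNorm c 0 n

/-- The recurrence coefficient `b_n = d_n h_n / h_{n-1}` for `n ≥ 1`, with `b_0 = 0`. -/
def recB (c : ℤ → ℂ) : ℕ → ℂ
  | 0 => 0
  | n + 1 => recD c (n + 1) * hNorm c 0 (n + 1) / hNorm c 0 n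

/-! ### The explicit coefficients as functions of the time `t` -/

/-- The closed form of `h_n` at parameter value `t`. -/
def ellH (L : PeriodPair) (w β γ : ℂ) (n : ℕ) (t : ℂ) : ℂ :=
  Complex.exp (γ * t) / sigma L t * (sigma L (t * (n + 1) + β) / sigma L (t * n + β)) *
    (ellFact L w n ^ 2 / (ellPoch L w (-(t / w) + 1) n * ellPoch L w (t / w + 1) n))

/-- The closed form of `h_n^{(1)}` at parameter value `t`. -/
def ellH1 (L : PeriodPair) (w β γ : ℂ) (n : ℕ) (t : ℂ) : ℂ :=
  Complex.exp (γ * (t + w)) / sigma L (t + w) *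
    (sigma L ((t + w) * (n + 1) + β) / sigma L ((t + w) * n + β)) *
    (ellFact L w n ^ 2 / (ellPoch L w (-(t / w)) n * ellPoch L w (t / w + 2) n))

/-- The explicit coefficient `d_n(t)`. -/
def ellD (L : PeriodPair) (w β γ : ℂ) (n : ℕ) (t : ℂ) : ℂ :=
  Complex.exp (γ * w) *
    ((ellNum L w (t / w - n) * ellNum L w (β / w + (t / w + 1) * (n + 1)) *
        ellNum L w (β / w + t / w * n)) /
      (ellNum L w (t / w + (n + 1)) * ellNum L w (β / w + (t / w + 1) * n) *
        ellNum L w (β / w + t / w * (n + 1))))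

/-- The explicit coefficient `b_n(t)`; it vanishes for `n = 0`. -/
def ellB (L : PeriodPair) (w β γ : ℂ) (n : ℕ) (t : ℂ) : ℂ :=
  -Complex.exp (γ * w) *
    ((ellNum L w n ^ 2 * ellNum L w (β / w + (t / w + 1) * (n + 1)) *
        ellNum L w (β / w + t / w * ((n : ℂ) - 1))) /
      (ellNum L w (β / w + (t / w + 1) * n) * ellNum L w (β / w + t / w * n) *
        ellNum L w (t / w + n) * ellNum L w (t / w + n + 1)))

/-- An elliptic function for the lattice of `L`: meromorphic and `Λ`-periodic. -/
def IsElliptic (L : PeriodPair) (f : ℂ → ℂ) : Prop :=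
  Meromorphic f ∧ ∀ s ∈ L.lattice, Function.Periodic f s

/-! ### The two `QD`-algorithms; `x j n` stands for `x_n^{(j)}`, discrete time `j ∈ ℤ` -/

/-- Nondegenerate solutions of the two-point `QD`-algorithm
`b_n d̃_n = d_{n-1} b̃_n` (`n ≥ 1`), `b̃_n - d̃_n = b_{n+1} - d_n` (`n ≥ 0`), `b_0 = 0`,
where the tilde is the shift `j ↦ j + 1`. -/
structure IsTwoPointQD (b d : ℤ → ℕ → ℂ) : Prop where
  b_zero : ∀ j, b j 0 = 0
  d_ne : ∀ j n, d j n ≠ 0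
  b_ne : ∀ j n, b j (n + 1) ≠ 0
  mul_rel : ∀ j n, b j (n + 1) * d (j + 1) (n + 1) = d j n * b (j + 1) (n + 1)
  add_rel : ∀ j n, b (j + 1) n - d (j + 1) n = b j (n + 1) - d j n

/-- The restricted discrete-time relativistic Toda chain, for `n ≥ 1`,
`d̃_n = d_{n-1} (b_{n+1} - d_n) / (b_n - d_{n-1})`,
`b̃_n = b_n (b_{n+1} - d_n) / (b_n - d_{n-1})`, where `b_0 = 0`, and `d̃_0 = d_0 - b_1`. -/
structure IsDiscreteRelToda (b d : ℤ → ℕ → ℂ) : Prop where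
  b_zero : ∀ j, b j 0 = 0
  d_zero : ∀ j, d (j + 1) 0 = d j 0 - b j 1
  den_ne : ∀ j n, b j (n + 1) - d j n ≠ 0
  d_rel : ∀ j n, d (j + 1) (n + 1) =
    d j n * ((b j (n + 2) - d j (n + 1)) / (b j (n + 1) - d j n))
  b_rel : ∀ j n, b (j + 1) (n + 1) =
    b j (n + 1) * ((b j (n + 2) - d j (n + 1)) / (b j (n + 1) - d j n))

/-- Nondegenerate solutions of the ordinary (Rutishauser) `QD`-algorithm
`e_{n-1}^{(j+1)} f_n^{(j+1)} = e_n^{(j)} f_n^{(j)}` (`n ≥ 1`),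
`e_n^{(j+1)} + f_n^{(j+1)} = e_n^{(j)} + f_{n+1}^{(j)}` (`n ≥ 0`), `f_0 = 0`. -/
structure IsQD (e f : ℤ → ℕ → ℂ) : Prop where
  f_zero : ∀ j, f j 0 = 0
  e_ne : ∀ j n, e j n ≠ 0
  f_ne : ∀ j n, f j (n + 1) ≠ 0
  mul_rel : ∀ j n, e (j + 1) n * f (j + 1) (n + 1) = e j (n + 1) * f j (n + 1)
  add_rel : ∀ j n, e (j + 1) n + f (j + 1) n = e j n + f j (n + 1)

end

end EllipticLBP

/-! The analytic input is the Weierstrass three-term identity for sigma (`sigma_three_term`). As a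
function of one argument, its left side picks up the same lattice multiplier as a product of two
sigmas with simple zeros, and it vanishes at those zeros. The quotient is therefore entire and
elliptic, hence constant by Liouville, and a special value shows that it is zero. Quasi-periodicity
of sigma comes from zeta, the logarithmic derivative of sigma, whose derivative is `-℘`.

In the form `sigma_schur`, this identity says that eliminating the first row and column of the
Toeplitz matrix of moments gives a matrix of the same kind with `β` replaced by `β + t`, up to row
and column factors. Induction gives the product formula `sigmaToeplitz_eq`, from which the
nonvanishing criterion and all closed forms follow.

The rest is linear algebra for an arbitrary moment sequence. A polynomial of degree below `n` with
`n` vanishing moments is zero when the Toeplitz determinant is not (`eq_zero_of_momentFun_eq_zero`).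
This gives two relations between the polynomials of `c` and of the shifted sequence,
`X_mul_lbp_shift` and `lbp_shift_succ`. Eliminating the shifted polynomials yields the recurrence;
compatibility of the relations over two time steps yields the two-point `QD`-algorithm
(`isTwoPointQD_of_relations`). Since moving `t` by `w` shifts the index of the moments, elliptic
moments give a solution, and reading it along the staircase `j + n` gives the ordinary
`QD`-algorithm. -/

namespace EllipticLBP

open Polynomial

/-! ### The Weierstrass sigma function -/

section Sigma

open Filter Topology

/-- The genus two elementary factor `(1 - z) exp (z + z² / 2)`. -/
noncomputable def primaryFactor (z : ℂ) : ℂ := (1 - z) * Complex.exp (z + z ^ 2 / 2)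

lemma hasDerivAt_primaryFactor (z : ℂ) :
    HasDerivAt primaryFactor (-z ^ 2 * Complex.exp (z + z ^ 2 / 2)) z := by
  have h1 : HasDerivAt (fun z : ℂ => 1 - z) (-1) z := by
    simpa using (hasDerivAt_id z).const_sub 1
  have h2 : HasDerivAt (fun z : ℂ => z + z ^ 2 / 2) (1 + z) z := by
    have := (hasDerivAt_id' z).fun_add (((hasDerivAt_id' z).fun_pow 2).div_const 2)
    simpa using this
  have := h1.mul h2.cexp
  refine this.congr_deriv ?_
  ring

lemma primaryFactor_zero : primaryFactor 0 = 1 := by simp [primaryFactor]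

lemma differentiable_primaryFactor : Differentiable ℂ primaryFactor :=
  fun z => (hasDerivAt_primaryFactor z).differentiableAt

lemma primaryFactor_eq_zero_iff (z : ℂ) : primaryFactor z = 0 ↔ z = 1 := by
  rw [primaryFactor, mul_eq_zero, or_iff_left (Complex.exp_ne_zero _), sub_eq_zero, eq_comm]

/-- The derivative vanishes to second order at the origin, so the mean value inequality on the ball
of radius `‖z‖` gives a cubic bound, enough for convergence over a lattice of rank two. -/
lemma norm_primaryFactor_sub_one_le {z : ℂ} (hz : ‖z‖ ≤ 1) :
    ‖primaryFactor z - 1‖ ≤ Real.exp 2 * ‖z‖ ^ 3 := by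
  have key := (convex_closedBall (0 : ℂ) ‖z‖).norm_image_sub_le_of_norm_hasDerivWithin_le
    (f := primaryFactor) (C := Real.exp 2 * ‖z‖ ^ 2) (x := 0) (y := z)
    (fun x _ => (hasDerivAt_primaryFactor x).hasDerivWithinAt) ?_ (by simp) (by simp)
  · rw [primaryFactor_zero, sub_zero] at key
    refine key.trans (le_of_eq (by ring))
  · intro x hx
    have hx : ‖x‖ ≤ ‖z‖ := by simpa using hx
    have hx1 := hx.trans hz
    rw [norm_mul, norm_neg, norm_pow, mul_comm]
    gcongr
    refine (Complex.norm_exp_le_exp_norm _).trans (Real.exp_le_exp.2 ?_)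
    calc ‖x + x ^ 2 / 2‖ ≤ ‖x‖ + ‖x ^ 2 / 2‖ := norm_add_le _ _
      _ = ‖x‖ + ‖x‖ ^ 2 / 2 := by simp
      _ ≤ 2 := by nlinarith [norm_nonneg x]

variable (L : PeriodPair)

lemma sigma_eq (u : ℂ) :
    sigma L u = u * ∏' s : {s : L.lattice // s ≠ 0}, primaryFactor (u / (s : ℂ)) := by
  unfold sigma primaryFactor
  congr 2
  ext s
  congr 3
  ring

lemma summable_lattice_norm_inv_cube :
    Summable fun s : {s : L.lattice // s ≠ 0} => ‖(s : ℂ)‖ ^ (-3 : ℝ) :=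
  Summable.comp_injective (f := fun s : L.lattice => ‖(s : ℂ)‖ ^ (-3 : ℝ))
    (ZLattice.summable_norm_rpow _ _ (by simp; norm_num)) Subtype.val_injective

lemma eventually_cofinite_le_norm (R : ℝ) :
    ∀ᶠ s : {s : L.lattice // s ≠ 0} in cofinite, R ≤ ‖(s : ℂ)‖ := by
  have h : ∀ᶠ s : L.lattice in cofinite, R ≤ ‖(s : ℂ)‖ := by
    refine (isCompact_iff_finite.mp (isCompact_closedBall (0 : L.lattice) R)).subset ?_
    intro l hl
    have hl : ‖(l : ℂ)‖ < R := by simpa using hl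
    simpa using hl.le
  exact Subtype.val_injective.tendsto_cofinite.eventually h

lemma norm_primaryFactor_div_sub_one_le {R : ℝ} (hR : 0 < R) {u s : ℂ} (hu : ‖u‖ ≤ R)
    (hs : R ≤ ‖s‖) :
    ‖primaryFactor (u / s) - 1‖ ≤ Real.exp 2 * R ^ 3 * ‖s‖ ^ (-3 : ℝ) := by
  have hs0 : 0 < ‖s‖ := hR.trans_le hs
  refine (norm_primaryFactor_sub_one_le ?_).trans ?_
  · rw [norm_div]
    exact div_le_one_of_le₀ (hu.trans hs) hs0.le
  · rw [norm_div, div_pow, mul_assoc]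
    have : ‖s‖ ^ (-3 : ℝ) = (‖s‖ ^ 3)⁻¹ := by
      rw [Real.rpow_neg hs0.le]; norm_cast
    rw [this, div_eq_mul_inv]
    gcongr

lemma multipliableLocallyUniformlyOn_primaryFactor :
    MultipliableLocallyUniformlyOn
      (fun (s : {s : L.lattice // s ≠ 0}) (u : ℂ) => primaryFactor (u / (s : ℂ))) Set.univ := by
  refine ⟨fun u => ∏' s : {s : L.lattice // s ≠ 0}, (1 + (primaryFactor (u / (s : ℂ)) - 1)), ?_⟩
  refine hasProdLocallyUniformlyOn_of_forall_compact isOpen_univ fun K _ hK => ?_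
  obtain ⟨R, hR0, hR⟩ := hK.isBounded.exists_pos_norm_le
  have := Summable.hasProdUniformlyOn_one_add (K := K)
    (f := fun (s : {s : L.lattice // s ≠ 0}) (u : ℂ) => primaryFactor (u / (s : ℂ)) - 1)
    hK ((summable_lattice_norm_inv_cube L).mul_left (Real.exp 2 * R ^ 3)) ?_ ?_
  · simpa using this
  · filter_upwards [eventually_cofinite_le_norm L R] with s hs u hu
    exact norm_primaryFactor_div_sub_one_le hR0 (hR u hu) hs
  · intro s
    exact ((differentiable_primaryFactor.continuous.comp (continuous_id.div_const _)).sub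
      continuous_const).continuousOn

lemma differentiable_tprod_primaryFactor :
    Differentiable ℂ
      (fun u => ∏' s : {s : L.lattice // s ≠ 0}, primaryFactor (u / (s : ℂ))) := by
  rw [← differentiableOn_univ]
  refine (multipliableLocallyUniformlyOn_primaryFactor L).hasProdLocallyUniformlyOn.differentiableOn
    (.of_forall fun t => .fun_finsetProd fun s _ => ?_) isOpen_univ
  exact (differentiable_primaryFactor.comp (differentiable_id.div_const _)).differentiableOn

/-- An absolutely convergent product without zero factors is nonzero. The case `u = 0` serves the
derivative of sigma at the origin. -/
lemma tprod_primaryFactor_ne_zero {u : ℂ} (hu : u ∉ L.lattice ∨ u = 0) :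
    ∏' s : {s : L.lattice // s ≠ 0}, primaryFactor (u / (s : ℂ)) ≠ 0 := by
  have := tprod_one_add_ne_zero_of_summable (R := ℂ)
    (f := fun s : {s : L.lattice // s ≠ 0} => primaryFactor (u / (s : ℂ)) - 1) ?_ ?_
  · simpa using this
  · intro s
    rw [add_sub_cancel, Ne, primaryFactor_eq_zero_iff, div_eq_one_iff_eq (by simpa using s.2)]
    rintro rfl
    rcases hu with h | h
    · exact h s.1.2
    · exact s.2 (by simpa using h)
  · refine Summable.of_norm_bounded_eventually
      ((summable_lattice_norm_inv_cube L).mul_left (Real.exp 2 * (‖u‖ + 1) ^ 3)) ?_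
    filter_upwards [eventually_cofinite_le_norm L (‖u‖ + 1)] with s hs
    rw [norm_norm]
    exact norm_primaryFactor_div_sub_one_le (by positivity) (by linarith) hs

lemma differentiable_sigma : Differentiable ℂ (sigma L) := by
  rw [funext (sigma_eq L)]
  exact differentiable_id.mul (differentiable_tprod_primaryFactor L)

lemma continuous_sigma : Continuous (sigma L) := (differentiable_sigma L).continuous

lemma sigma_zero : sigma L 0 = 0 := by simp [sigma]

lemma sigma_eq_zero_iff {u : ℂ} : sigma L u = 0 ↔ u ∈ L.lattice := by
  rw [sigma_eq]
  refine ⟨fun h => ?_, fun h => ?_⟩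
  · by_contra hu
    refine mul_ne_zero ?_ (tprod_primaryFactor_ne_zero L (Or.inl hu)) h
    rintro rfl
    exact hu (zero_mem _)
  · by_cases h0 : u = 0
    · simp [h0]
    · rw [tprod_of_exists_eq_zero ⟨⟨⟨u, h⟩, by simpa using h0⟩, ?_⟩, mul_zero]
      simp [primaryFactor_eq_zero_iff, h0]

lemma sigma_ne_zero {u : ℂ} (hu : u ∉ L.lattice) : sigma L u ≠ 0 :=
  (sigma_eq_zero_iff L).not.2 hu

lemma sigma_neg (u : ℂ) : sigma L (-u) = -sigma L u := by
  rw [sigma_eq, sigma_eq, neg_mul]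
  congr 2
  let e : {s : L.lattice // s ≠ 0} ≃ {s : L.lattice // s ≠ 0} :=
    (Equiv.neg L.lattice).subtypeEquiv (by simp)
  rw [← e.tprod_eq]
  simp [e]

lemma deriv_sigma_zero_ne_zero : deriv (sigma L) 0 ≠ 0 := by
  rw [funext (sigma_eq L), deriv_fun_mul differentiableAt_fun_id
    (differentiable_tprod_primaryFactor L 0)]
  simpa using tprod_primaryFactor_ne_zero L (u := 0) (Or.inr rfl)

end Sigma

/-! ### The Weierstrass zeta function and quasi-periodicity of sigma -/

section Zeta

open Filter Topology

variable (L : PeriodPair)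

/-- The Weierstrass zeta function. The term of `l = 0` is `1 / u`. -/
noncomputable def zeta (u : ℂ) : ℂ :=
  ∑' l : L.lattice, (1 / (u - l) + 1 / (l : ℂ) + u / (l : ℂ) ^ 2)

lemma norm_zeta_term_le {r : ℝ} {u l : ℂ} (hr : 0 < r) (hu : ‖u‖ < r) (hl : 2 * r ≤ ‖l‖) :
    ‖1 / (u - l) + 1 / l + u / l ^ 2‖ ≤ 2 * r ^ 2 * ‖l‖ ^ (-3 : ℝ) := by
  have hl0 : 0 < ‖l‖ := by linarith
  have hl1 : l ≠ 0 := norm_pos_iff.1 hl0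
  have hul : ‖l‖ / 2 ≤ ‖u - l‖ := by
    have := norm_sub_norm_le l u
    rw [norm_sub_rev] at this
    linarith
  have hul0 : u - l ≠ 0 := norm_pos_iff.1 (by linarith)
  -- The two correction terms cancel the expansion of `1 / (u - l)` through first order in `u`,
  -- leaving cubic decay in `l`.
  have h1 : 1 / (u - l) + 1 / l + u / l ^ 2 = u ^ 2 / (l ^ 2 * (u - l)) := by
    field_simp
    ring
  have h2 : ‖l‖ ^ (-3 : ℝ) = (‖l‖ ^ 3)⁻¹ := by
    rw [Real.rpow_neg hl0.le]; norm_cast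
  rw [h1, h2, norm_div, norm_mul, norm_pow, norm_pow]
  calc ‖u‖ ^ 2 / (‖l‖ ^ 2 * ‖u - l‖) ≤ r ^ 2 / (‖l‖ ^ 2 * (‖l‖ / 2)) := by gcongr
    _ = 2 * r ^ 2 * (‖l‖ ^ 3)⁻¹ := by field_simp

lemma hasSumLocallyUniformly_zeta :
    HasSumLocallyUniformly
      (fun (l : L.lattice) (u : ℂ) => 1 / (u - l) + 1 / (l : ℂ) + u / (l : ℂ) ^ 2) (zeta L) := by
  refine L.hasSumLocallyUniformly_aux (u := fun r l => 2 * r ^ 2 * ‖l‖ ^ (-3 : ℝ)) _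
    (fun _ _ => (ZLattice.summable_norm_rpow _ _ (by simp; norm_num)).mul_left _) fun r hr =>
    Filter.eventually_atTop.mpr ⟨2 * r, ?_⟩
  rintro _ h s hs l rfl
  exact norm_zeta_term_le hr hs h

lemma hasDerivAt_zeta_term {u l : ℂ} (h : u - l ≠ 0) :
    HasDerivAt (fun u : ℂ => 1 / (u - l) + 1 / l + u / l ^ 2) (-(1 / (u - l) ^ 2 - 1 / l ^ 2)) u := by
  have h1 := ((hasDerivAt_id' u).sub_const l).fun_inv h
  have h2 := (h1.add_const (1 / l)).fun_add ((hasDerivAt_id' u).div_const (l ^ 2))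
  simp only [one_div] at *
  refine h2.congr_deriv ?_
  ring

lemma sub_ne_zero_of_notMem_lattice {u : ℂ} (hu : u ∈ (L.lattice : Set ℂ)ᶜ) (l : L.lattice) :
    u - l ≠ 0 := by
  rw [sub_ne_zero]
  rintro rfl
  exact hu l.2

lemma isOpen_compl_lattice : IsOpen (L.lattice : Set ℂ)ᶜ := L.isClosed_lattice.isOpen_compl

lemma differentiableOn_zeta : DifferentiableOn ℂ (zeta L) (L.lattice : Set ℂ)ᶜ := by
  refine (hasSumLocallyUniformly_zeta L).hasSumLocallyUniformlyOn.differentiableOn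
    (.of_forall fun s => .fun_sum fun l _ u hu => ?_) (isOpen_compl_lattice L)
  exact (hasDerivAt_zeta_term
    (sub_ne_zero_of_notMem_lattice L hu l)).differentiableAt.differentiableWithinAt

lemma deriv_zeta : Set.EqOn (deriv (zeta L)) (fun u => -L.weierstrassP u) (L.lattice : Set ℂ)ᶜ := by
  refine ((hasSumLocallyUniformly_zeta L).tendstoLocallyUniformlyOn.deriv
    (.of_forall fun s => .fun_sum fun l _ u hu => ?_) (isOpen_compl_lattice L)).unique ?_
  · exact (hasDerivAt_zeta_term
      (sub_ne_zero_of_notMem_lattice L hu l)).differentiableAt.differentiableWithinAt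
  · have h := L.hasSumLocallyUniformly_weierstrassP.tendstoLocallyUniformlyOn
      (s := (L.lattice : Set ℂ)ᶜ)
    have h' := h.neg
    refine h'.congr ?_
    intro s u hu
    have := HasDerivAt.fun_sum (u := s) fun l _ =>
      hasDerivAt_zeta_term (sub_ne_zero_of_notMem_lattice L hu l)
    simp only [Function.comp_apply]
    rw [this.deriv]
    simp

lemma logDeriv_primaryFactor_div {u s : ℂ} (hs : s ≠ 0) (hus : u - s ≠ 0) :
    logDeriv (fun u => primaryFactor (u / s)) u = 1 / (u - s) + 1 / s + u / s ^ 2 := by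
  have h := (hasDerivAt_primaryFactor (u / s)).comp u ((hasDerivAt_id' u).div_const s)
  have h' : deriv (fun u => primaryFactor (u / s)) u = _ := h.deriv
  have hus' : s - u ≠ 0 := by rw [← neg_sub]; exact neg_ne_zero.2 hus
  have h1 : 1 - u / s = (s - u) / s := by field_simp
  rw [logDeriv_apply, h', primaryFactor, h1]
  have := Complex.exp_ne_zero (u / s + (u / s) ^ 2 / 2)
  generalize Complex.exp (u / s + (u / s) ^ 2 / 2) = E at *
  field_simp
  ring

lemma summable_zeta (u : ℂ) :
    Summable fun l : L.lattice => 1 / (u - l) + 1 / (l : ℂ) + u / (l : ℂ) ^ 2 :=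
  (hasSumLocallyUniformly_zeta L).hasSum.summable

lemma zeta_eq_add_tsum (u : ℂ) :
    zeta L u = 1 / u + ∑' s : {s : L.lattice // s ≠ 0},
      (1 / (u - (s : ℂ)) + 1 / (s : ℂ) + u / (s : ℂ) ^ 2) := by
  have h := (summable_zeta L u).tsum_subtype_add_tsum_subtype_compl {0}
  rw [zeta, ← h, tsum_singleton (0 : L.lattice)
    (fun l : L.lattice => 1 / (u - l) + 1 / (l : ℂ) + u / (l : ℂ) ^ 2)]
  simp
  rfl

lemma logDeriv_sigma {u : ℂ} (hu : u ∉ L.lattice) : logDeriv (sigma L) u = zeta L u := by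
  have hu0 : u ≠ 0 := by
    rintro rfl
    exact hu (zero_mem _)
  rw [funext (sigma_eq L), logDeriv_mul u hu0 (tprod_primaryFactor_ne_zero L (Or.inl hu))
    differentiableAt_fun_id (differentiable_tprod_primaryFactor L u), zeta_eq_add_tsum]
  have hs : ∀ s : {s : L.lattice // s ≠ 0}, (s : ℂ) ≠ 0 := fun s => by simpa using s.2
  have key : ∀ s : {s : L.lattice // s ≠ 0},
      logDeriv (fun u => primaryFactor (u / (s : ℂ))) u
        = 1 / (u - (s : ℂ)) + 1 / (s : ℂ) + u / (s : ℂ) ^ 2 := fun s =>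
    logDeriv_primaryFactor_div (hs s) (sub_ne_zero_of_notMem_lattice L hu s.1)
  congr 1
  · simp [logDeriv_apply]
  rw [logDeriv_tprod_eq_tsum isOpen_univ (Set.mem_univ u) ?_ ?_ ?_
    (multipliableLocallyUniformlyOn_primaryFactor L) (tprod_primaryFactor_ne_zero L (Or.inl hu))]
  · exact tsum_congr key
  · intro s
    rw [Ne, primaryFactor_eq_zero_iff, div_eq_one_iff_eq (hs s)]
    rintro rfl
    exact hu s.1.2
  · exact fun s => (differentiable_primaryFactor.comp
      (differentiable_id.div_const _)).differentiableOn
  · simp_rw [key]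
    exact (summable_zeta L u).comp_injective Subtype.val_injective

/-- Needed so that a vanishing derivative off the lattice forces a single constant. -/
lemma isPreconnected_compl_lattice : IsPreconnected (L.lattice : Set ℂ)ᶜ :=
  (Set.Countable.isConnected_compl_of_one_lt_rank (by simp)
    (countable_of_Lindelof_of_discrete (X := L.lattice))).2

lemma add_notMem_lattice {u s : ℂ} (hs : s ∈ L.lattice) (hu : u ∈ (L.lattice : Set ℂ)ᶜ) :
    u + s ∈ (L.lattice : Set ℂ)ᶜ :=
  fun h => hu (by simpa using sub_mem h hs)

/-- Periodicity of `℘` makes the derivative of `zeta L (u + s) - zeta L u` zero on the connected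
complement of the lattice. -/
lemma exists_zeta_add {s : ℂ} (hs : s ∈ L.lattice) :
    ∃ η : ℂ, ∀ u ∉ L.lattice, zeta L (u + s) = zeta L u + η := by
  have hd := fun u (hu : u ∈ (L.lattice : Set ℂ)ᶜ) =>
    (differentiableOn_zeta L).differentiableAt ((isOpen_compl_lattice L).mem_nhds hu)
  have hd' : ∀ u ∈ (L.lattice : Set ℂ)ᶜ, HasDerivAt (fun u => zeta L (u + s) - zeta L u) 0 u := by
    intro u hu
    have hus := add_notMem_lattice L hs hu
    refine (((hd _ hus).hasDerivAt.comp_add_const _ _).fun_sub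
      (hd u hu).hasDerivAt).congr_deriv ?_
    rw [deriv_zeta L hu, deriv_zeta L hus]
    have := L.weierstrassP_add_coe u ⟨s, hs⟩
    simp_all
  obtain ⟨η, hη⟩ := (isOpen_compl_lattice L).exists_is_const_of_deriv_eq_zero
    (isPreconnected_compl_lattice L)
    (fun u hu => (hd' u hu).differentiableAt.differentiableWithinAt)
    (fun u hu => (hd' u hu).deriv)
  exact ⟨η, fun u hu => by rw [← hη u hu]; ring⟩

lemma dense_compl_lattice : Dense (L.lattice : Set ℂ)ᶜ :=
  Set.Countable.dense_compl ℝ (countable_of_Lindelof_of_discrete (X := L.lattice))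

/-- Quasi-periodicity of the sigma function. -/
lemma exists_sigma_add {s : ℂ} (hs : s ∈ L.lattice) :
    ∃ C η : ℂ, C ≠ 0 ∧ C ^ 2 = Complex.exp (η * s) ∧
      ∀ u, sigma L (u + s) = C * Complex.exp (η * u) * sigma L u := by
  obtain ⟨η, hη⟩ := exists_zeta_add L hs
  have hd := differentiable_sigma L
  have hdiff : ∀ u ∈ (L.lattice : Set ℂ)ᶜ, HasDerivAt
      (fun u => sigma L (u + s) / (Complex.exp (η * u) * sigma L u)) 0 u := by
    intro u hu
    have hus := add_notMem_lattice L hs hu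
    have h0 : sigma L u ≠ 0 := sigma_ne_zero L hu
    have h0' : sigma L (u + s) ≠ 0 := sigma_ne_zero L hus
    have h1 : HasDerivAt (sigma L) (zeta L u * sigma L u) u := by
      refine (hd u).hasDerivAt.congr_deriv ?_
      rw [← logDeriv_sigma L hu, logDeriv_apply]
      field_simp
    have h2 : HasDerivAt (fun u => sigma L (u + s)) (zeta L (u + s) * sigma L (u + s)) u := by
      refine ((hd (u + s)).hasDerivAt.congr_deriv ?_).comp_add_const _ _
      rw [← logDeriv_sigma L hus, logDeriv_apply]
      field_simp
    have h3 : HasDerivAt (fun u => Complex.exp (η * u)) (Complex.exp (η * u) * η) u := by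
      simpa using ((hasDerivAt_id' u).const_mul η).cexp
    refine (h2.fun_div (h3.fun_mul h1)
      (mul_ne_zero (Complex.exp_ne_zero _) h0)).congr_deriv ?_
    rw [hη u hu, div_eq_zero_iff]
    left
    ring
  obtain ⟨C, hC⟩ := (isOpen_compl_lattice L).exists_is_const_of_deriv_eq_zero
    (f := fun u => sigma L (u + s) / (Complex.exp (η * u) * sigma L u))
    (isPreconnected_compl_lattice L)
    (fun u hu => (hdiff u hu).differentiableAt.differentiableWithinAt)
    (fun u hu => (hdiff u hu).deriv)
  · have key : ∀ u, sigma L (u + s) = C * Complex.exp (η * u) * sigma L u := by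
      refine congr_fun (Continuous.ext_on (dense_compl_lattice L) ?_ ?_ fun u hu => ?_)
      · exact (continuous_sigma L).comp (continuous_id.add continuous_const)
      · have := continuous_sigma L
        fun_prop
      · have := hC u hu
        have h0 : sigma L u ≠ 0 := sigma_ne_zero L hu
        have h1 := Complex.exp_ne_zero (η * u)
        rw [← this]
        field_simp
    have hne := sigma_ne_zero L L.ω₁_div_two_notMem_lattice
    have hne' := sigma_ne_zero L (add_notMem_lattice L hs L.ω₁_div_two_notMem_lattice)
    refine ⟨C, η, ?_, ?_, key⟩
    · rintro rfl
      simp [key] at hne'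
    · set u := L.ω₁ / 2
      have h1 := key u
      -- Oddness of sigma determines `C ^ 2`: translating `-(u + s)` by `s` gives `-u`, so the
      -- quasi-periodicity relation is used in both directions.
      have h2 := key (-(u + s))
      have h3 : -(u + s) + s = -u := by ring
      rw [h3, sigma_neg, sigma_neg, h1, neg_eq_iff_eq_neg] at h2
      have h4 : Complex.exp (η * -(u + s)) * Complex.exp (η * u) * Complex.exp (η * s) = 1 := by
        rw [← Complex.exp_add, ← Complex.exp_add, ← Complex.exp_zero]
        congr 1
        ring
      refine mul_right_cancel₀ hne ?_
      generalize Complex.exp (η * -(u + s)) = E1 at *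
      generalize Complex.exp (η * u) = E2 at *
      generalize Complex.exp (η * s) = E3 at *
      linear_combination (-E3) * h2 + (-C ^ 2 * sigma L u) * h4

end Zeta

/-! ### Removable singularities and Liouville's theorem -/

section Division

open Filter Topology

/-- An entire function divided by an entire function whose zeros are simple and are zeros of the
numerator is entire. -/
lemma exists_differentiable_mul_eq {F G : ℂ → ℂ} (hF : Differentiable ℂ F)
    (hG : Differentiable ℂ G) (h : ∀ p, G p = 0 → F p = 0 ∧ deriv G p ≠ 0) :
    ∃ H : ℂ → ℂ, Differentiable ℂ H ∧ ∀ z, F z = H z * G z := by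
  classical
  -- At a zero of `G` the value is the l'Hôpital limit, so near such a point the function is a
  -- quotient of difference quotients (`dslope`).
  refine ⟨fun z => if G z = 0 then deriv F z / deriv G z else F z / G z, fun p => ?_, fun z => ?_⟩
  · by_cases hp : G p = 0
    · obtain ⟨hFp, hGp⟩ := h p hp
      have hdF : DifferentiableAt ℂ (dslope F p) p :=
        ((Complex.differentiableOn_dslope univ_mem).2 hF.differentiableOn).differentiableAt univ_mem
      have hdG : DifferentiableAt ℂ (dslope G p) p :=
        ((Complex.differentiableOn_dslope univ_mem).2 hG.differentiableOn).differentiableAt univ_mem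
      have hne : dslope G p p ≠ 0 := by rwa [dslope_same]
      refine (hdF.fun_div hdG hne).congr_of_eventuallyEq ?_
      filter_upwards [hdG.continuousAt.eventually_ne hne] with z hz
      by_cases hzp : z = p
      · subst hzp
        rw [if_pos hp, dslope_same, dslope_same]
      · have h1 := sub_smul_dslope F p z
        have h2 := sub_smul_dslope G p z
        rw [hFp, sub_zero, smul_eq_mul] at h1
        rw [hp, sub_zero, smul_eq_mul] at h2
        have h3 : z - p ≠ 0 := sub_ne_zero.2 hzp
        rw [← h1, ← h2, if_neg (mul_ne_zero h3 hz), mul_div_mul_left _ _ h3]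
    · refine ((hF p).fun_div (hG p) hp).congr_of_eventuallyEq ?_
      filter_upwards [(hG p).continuousAt.eventually_ne hp] with z hz
      rw [if_neg hz]
  · dsimp only
    split_ifs with hz
    · rw [hz, (h z hz).1, mul_zero]
    · rw [div_mul_cancel₀ _ hz]

/-- Liouville's theorem for elliptic functions. -/
lemma apply_eq_apply_of_entire_of_periodic (L : PeriodPair) {f : ℂ → ℂ} (hf : Differentiable ℂ f)
    (hp : ∀ s ∈ L.lattice, Function.Periodic f s) (z w : ℂ) : f z = f w := by
  refine hf.apply_eq_apply_of_bounded ?_ z w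
  have hb := (ZSpan.fundamentalDomain_isBounded L.basis).isCompact_closure.image hf.continuous
  refine hb.isBounded.subset ?_
  rintro _ ⟨z, rfl⟩
  refine ⟨ZSpan.fract L.basis z, subset_closure (ZSpan.fract_mem_fundamentalDomain _ _), ?_⟩
  rw [ZSpan.fract_apply]
  refine (hp _ ?_).sub_eq z
  rw [L.lattice_eq_span_range_basis]
  exact (ZSpan.floor L.basis z).2

end Division

/-! ### The Weierstrass three-term identity -/

section ThreeTerm

variable (L : PeriodPair)

lemma deriv_sigma_ne_zero {s : ℂ} (hs : s ∈ L.lattice) : deriv (sigma L) s ≠ 0 := by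
  obtain ⟨C, η, hC, -, h⟩ := exists_sigma_add L hs
  have h1 : deriv (fun u => sigma L (u + s)) 0 = deriv (sigma L) s := by
    rw [deriv_comp_add_const, zero_add]
  have h2 : HasDerivAt (fun u => C * Complex.exp (η * u) * sigma L u)
      (C * deriv (sigma L) 0) 0 := by
    have h3 := (((hasDerivAt_id' (0 : ℂ)).const_mul η).cexp.const_mul C).fun_mul
      (differentiable_sigma L 0).hasDerivAt
    refine h3.congr_deriv ?_
    simp [sigma_zero]
  rw [← h1, funext h, h2.deriv]
  exact mul_ne_zero hC (deriv_sigma_zero_ne_zero L)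

lemma countable_lattice : (L.lattice : Set ℂ).Countable :=
  countable_of_Lindelof_of_discrete (X := L.lattice)

lemma dense_preimage_compl_lattice {f : ℂ → ℂ} (hf : Function.Injective f) :
    Dense {z | f z ∉ L.lattice} :=
  ((countable_lattice L).preimage hf).dense_compl ℝ

lemma dense_add_sub_notMem_lattice (d : ℂ) :
    Dense {z | z + d ∉ L.lattice ∧ z - d ∉ L.lattice} := by
  refine ((((countable_lattice L).preimage (add_left_injective d)).union
    ((countable_lattice L).preimage (sub_left_injective (b := d)))).dense_compl ℝ).mono
    fun z hz => ?_
  simpa using hz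

/-- The left-hand side of the Weierstrass three-term identity. -/
noncomputable def threeTerm (a b c d : ℂ) : ℂ :=
  sigma L (a + b) * sigma L (a - b) * (sigma L (c + d) * sigma L (c - d)) +
    sigma L (b + c) * sigma L (b - c) * (sigma L (a + d) * sigma L (a - d)) +
    sigma L (c + a) * sigma L (c - a) * (sigma L (b + d) * sigma L (b - d))

/-- The exponentials at `u + v` and `u - v` combine so that `v` cancels. All three summands of
`threeTerm` thus share one multiplier in `a`. -/
lemma exists_sigma_mul_add {s : ℂ} (hs : s ∈ L.lattice) :
    ∃ m : ℂ → ℂ, (∀ u, m u ≠ 0) ∧ ∀ u v,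
      sigma L (u + s + v) * sigma L (u + s - v) = m u * (sigma L (u + v) * sigma L (u - v)) := by
  obtain ⟨C, η, hC, -, h⟩ := exists_sigma_add L hs
  refine ⟨fun u => C ^ 2 * Complex.exp (2 * η * u),
    fun u => mul_ne_zero (pow_ne_zero _ hC) (Complex.exp_ne_zero _), fun u v => ?_⟩
  have h1 : Complex.exp (2 * η * u) = Complex.exp (η * (u + v)) * Complex.exp (η * (u - v)) := by
    rw [← Complex.exp_add]
    congr 1
    ring
  have h2 : u + s + v = u + v + s := by ring
  have h3 : u + s - v = u - v + s := by ring
  simp only [h1, h2, h3, h]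
  ring

lemma sigma_sub_comm (u v : ℂ) : sigma L (u - v) = -sigma L (v - u) := by
  rw [← neg_sub, sigma_neg]

lemma threeTerm_add {s : ℂ} {m : ℂ → ℂ} (hm : ∀ u v,
      sigma L (u + s + v) * sigma L (u + s - v) = m u * (sigma L (u + v) * sigma L (u - v)))
    (a b c d : ℂ) : threeTerm L (a + s) b c d = m a * threeTerm L a b c d := by
  unfold threeTerm
  rw [sigma_sub_comm L c (a + s), sigma_sub_comm L c a, add_comm c (a + s), add_comm c a, hm]
  linear_combination (sigma L (b + c) * sigma L (b - c)) * hm a d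
    - (sigma L (b + d) * sigma L (b - d)) * hm a c

lemma threeTerm_self (a c d : ℂ) : threeTerm L a a c d = 0 := by
  unfold threeTerm
  rw [sub_self, sigma_zero, sigma_sub_comm L c a, add_comm c a]
  ring

lemma threeTerm_self_right (a b c : ℂ) : threeTerm L a b c a = 0 := by
  unfold threeTerm
  rw [sub_self, sigma_zero, sigma_sub_comm L b a, add_comm b a]
  ring

lemma threeTerm_neg_right (a b c d : ℂ) : threeTerm L a b c (-d) = threeTerm L a b c d := by
  unfold threeTerm
  simp only [sub_neg_eq_add, ← sub_eq_add_neg]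
  ring

/-- In the variable `a`, divide by `σ(a + d) σ(a - d)`. The condition on `2 * d` keeps the zeros of
the two factors disjoint, hence simple; the conditions on `b ± d` make the divisor nonzero at `a =
b`, where the numerator vanishes. -/
lemma threeTerm_eq_zero_of_generic {b c d : ℂ} (hd : 2 * d ∉ L.lattice) (hbd : b + d ∉ L.lattice)
    (hbd' : b - d ∉ L.lattice) (a : ℂ) : threeTerm L a b c d = 0 := by
  have hσ := differentiable_sigma L
  have hF : Differentiable ℂ fun a => threeTerm L a b c d := by
    unfold threeTerm
    fun_prop
  have hG : Differentiable ℂ fun a => sigma L (a + d) * sigma L (a - d) := by fun_prop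
  have hz : ∀ p, sigma L (p + d) * sigma L (p - d) = 0 →
      threeTerm L p b c d = 0 ∧ deriv (fun a => sigma L (a + d) * sigma L (a - d)) p ≠ 0 := by
    intro p hp
    rw [deriv_fun_mul (by fun_prop) (by fun_prop), deriv_comp_add_const, deriv_comp_sub_const]
    rcases mul_eq_zero.1 hp with h | h
    · have hs := (sigma_eq_zero_iff L).1 h
      have hs' : p - d ∉ L.lattice := fun h' => hd (by
        have := sub_mem hs h'
        ring_nf at this ⊢
        exact this)
      obtain ⟨m, -, hm⟩ := exists_sigma_mul_add L hs
      constructor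
      · have := threeTerm_add L hm (-d) b c (-d)
        rw [threeTerm_self_right, threeTerm_neg_right] at this
        simpa using this
      · rw [h, zero_mul, add_zero]
        exact mul_ne_zero (deriv_sigma_ne_zero L hs) (sigma_ne_zero L hs')
    · have hs := (sigma_eq_zero_iff L).1 h
      have hs' : p + d ∉ L.lattice := fun h' => hd (by
        have := sub_mem h' hs
        ring_nf at this ⊢
        exact this)
      obtain ⟨m, -, hm⟩ := exists_sigma_mul_add L hs
      constructor
      · have := threeTerm_add L hm d b c d
        rw [threeTerm_self_right] at this
        simpa using this
      · rw [h, mul_zero, zero_add]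
        exact mul_ne_zero (sigma_ne_zero L hs') (deriv_sigma_ne_zero L hs)
  obtain ⟨H, hH, hFH⟩ := exists_differentiable_mul_eq hF hG hz
  have hper : ∀ s ∈ L.lattice, Function.Periodic H s := by
    intro s hs
    obtain ⟨m, hm0, hm⟩ := exists_sigma_mul_add L hs
    refine congr_fun (Continuous.ext_on (dense_add_sub_notMem_lattice L d)
      (hH.continuous.comp (continuous_id.add continuous_const)) hH.continuous fun a ha => ?_)
    have h1 := hFH (a + s)
    have h2 := hFH a
    have h3 := mul_ne_zero (sigma_ne_zero L ha.1) (sigma_ne_zero L ha.2)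
    rw [threeTerm_add L hm, h2, hm] at h1
    refine (mul_left_cancel₀ (mul_ne_zero (hm0 a) h3) ?_).symm
    linear_combination h1
  have hb : H b = 0 := by
    have h1 := hFH b
    rw [threeTerm_self] at h1
    exact (mul_eq_zero.1 h1.symm).resolve_right
      (mul_ne_zero (sigma_ne_zero L hbd) (sigma_ne_zero L hbd'))
  rw [hFH a, apply_eq_apply_of_entire_of_periodic L hH hper a b, hb, zero_mul]

/-- The exceptional values of `b`, then of `d`, have dense complement, so continuity removes the
genericity conditions. -/
lemma sigma_three_term (a b c d : ℂ) : threeTerm L a b c d = 0 := by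
  have hσ := continuous_sigma L
  have h1 : ∀ d, 2 * d ∉ L.lattice → ∀ b, threeTerm L a b c d = 0 := by
    intro d hd
    refine congr_fun (Continuous.ext_on (dense_add_sub_notMem_lattice L d) (g := fun _ => 0) ?_
      continuous_const fun b hb => threeTerm_eq_zero_of_generic L hd hb.1 hb.2 a)
    unfold threeTerm
    fun_prop
  refine congr_fun (Continuous.ext_on (dense_preimage_compl_lattice L
    (mul_right_injective₀ (two_ne_zero (α := ℂ)))) (f := fun d => threeTerm L a b c d) (g := fun _ => 0) ?_
    continuous_const fun d hd => h1 d hd b) d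
  unfold threeTerm
  fun_prop

/-- The three-term identity in the form used for the Schur complement. -/
lemma sigma_schur (x y t β : ℂ) :
    sigma L (x + y - t + β) * sigma L (t + β) * (sigma L x * sigma L y) -
      sigma L (x + β) * sigma L (y + β) * (sigma L (x + y - t) * sigma L t) =
    sigma L (x - t) * sigma L (y - t) * (sigma L (x + y + β) * sigma L β) := by
  -- These arguments are the half sums and half differences that turn the twelve sigma arguments
  -- into those of the Schur complement.
  have h := sigma_three_term L (β + (x + y) / 2) ((x + y) / 2 - t) ((x + y) / 2) ((x - y) / 2)
  unfold threeTerm at h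
  have e1 : β + (x + y) / 2 + ((x + y) / 2 - t) = x + y - t + β := by ring
  have e2 : β + (x + y) / 2 - ((x + y) / 2 - t) = t + β := by ring
  have e3 : (x + y) / 2 + (x - y) / 2 = x := by ring
  have e4 : (x + y) / 2 - (x - y) / 2 = y := by ring
  have e5 : (x + y) / 2 - t + (x + y) / 2 = x + y - t := by ring
  have e6 : (x + y) / 2 - t - (x + y) / 2 = -t := by ring
  have e7 : β + (x + y) / 2 + (x - y) / 2 = x + β := by ring
  have e8 : β + (x + y) / 2 - (x - y) / 2 = y + β := by ring
  have e9 : (x + y) / 2 + (β + (x + y) / 2) = x + y + β := by ring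
  have e10 : (x + y) / 2 - (β + (x + y) / 2) = -β := by ring
  have e11 : (x + y) / 2 - t + (x - y) / 2 = x - t := by ring
  have e12 : (x + y) / 2 - t - (x - y) / 2 = y - t := by ring
  rw [e1, e2, e3, e4, e5, e6, e7, e8, e9, e10, e11, e12, sigma_neg, sigma_neg] at h
  linear_combination h

end ThreeTerm

/-! ### The elliptic Toeplitz determinant -/

section Determinant

lemma det_eq_mul_det_schur {n : ℕ} (M : Matrix (Fin (n + 1)) (Fin (n + 1)) ℂ) (h : M 0 0 ≠ 0) :
    M.det = M 0 0 * Matrix.det (Matrix.of fun i k : Fin n =>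
      M i.succ k.succ - M i.succ 0 / M 0 0 * M 0 k.succ) := by
  let B : Matrix (Fin (n + 1)) (Fin (n + 1)) ℂ := Matrix.of fun i k =>
    M i k - (if i = 0 then 0 else M i 0 / M 0 0) * M 0 k
  have hMB : M.det = B.det := by
    refine Matrix.det_eq_of_forall_row_eq_smul_add_const
      (fun i => if i = 0 then 0 else M i 0 / M 0 0) 0 (by simp) fun i k => ?_
    simp [B]
  have hB0 : B 0 0 = M 0 0 := by simp [B]
  have hB : ∀ i : Fin n, B i.succ 0 = 0 := fun i => by simp [B, h]
  rw [hMB, Matrix.det_succ_column_zero, Fin.sum_univ_succ, Finset.sum_eq_zero, add_zero, hB0]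
  · simp only [Fin.val_zero, pow_zero, one_mul]
    congr 2
  · intro i _
    rw [hB]
    ring

variable (L : PeriodPair)

/-- The Toeplitz determinant of the elliptic moments without their exponential factors. -/
noncomputable def sigmaToeplitz (w t β : ℂ) (n : ℕ) : ℂ :=
  Matrix.det (Matrix.of fun i k : Fin n =>
    sigma L (w * ((k : ℕ) - (i : ℕ)) + β + t) /
      (sigma L (w * ((k : ℕ) - (i : ℕ)) + t) * sigma L β))

/-- The factor produced by eliminating the first row and column of a Toeplitz determinant. -/
noncomputable def schurFactor (w t : ℂ) (m : ℕ) : ℂ :=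
  sigma L (w * (m + 1)) ^ 2 / (sigma L (w * (m + 1) + t) * sigma L (w * (m + 1) - t))

lemma sigma_ne_zero_of_shift {w t : ℂ} (ht : ∀ m : ℤ, t + m * w ∉ L.lattice) (m : ℤ) :
    sigma L (w * m + t) ≠ 0 := by
  refine sigma_ne_zero L ?_
  rw [add_comm, mul_comm]
  exact ht m

/-- By `sigma_schur`, each entry of the Schur complement is the entry with parameter `β + t` times a
factor of its row and a factor of its column. Pulling these out gives the product of `schurFactor`s.
-/
lemma sigmaToeplitz_succ {w t β : ℂ} (ht : ∀ m : ℤ, t + m * w ∉ L.lattice) (hβ : β ∉ L.lattice)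
    (htβ : β + t ∉ L.lattice) (n : ℕ) :
    sigmaToeplitz L w t β (n + 1) = sigma L (β + t) / (sigma L t * sigma L β) *
      ((∏ m ∈ Finset.range n, schurFactor L w t m) * sigmaToeplitz L w t (β + t) n) := by
  have hσ := sigma_ne_zero_of_shift L ht
  have hσt : sigma L t ≠ 0 := by simpa using hσ 0
  have hσβ := sigma_ne_zero L hβ
  have hσtβ := sigma_ne_zero L htβ
  rw [sigmaToeplitz, det_eq_mul_det_schur]
  swap
  · simp [hσt, hσβ, hσtβ]
  congr 1
  · simp
  rw [← Fin.prod_univ_eq_prod_range]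
  have hprod : ∏ i : Fin n, schurFactor L w t i =
      (∏ i : Fin n, sigma L (w * ((i : ℕ) + 1)) / sigma L (w * ((i : ℕ) + 1) - t)) *
      ∏ k : Fin n, sigma L (w * ((k : ℕ) + 1)) / sigma L (w * ((k : ℕ) + 1) + t) := by
    rw [← Finset.prod_mul_distrib]
    refine Finset.prod_congr rfl fun i _ => ?_
    rw [schurFactor, div_mul_div_comm, sq, mul_comm (sigma L (_ + t))]
  rw [hprod, mul_assoc, sigmaToeplitz, ← Matrix.det_mul_row, ← Matrix.det_mul_column]
  congr 1
  ext i k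
  simp only [Matrix.of_apply, Fin.val_zero, Fin.val_succ, Nat.cast_zero, Nat.cast_add, Nat.cast_one]
  have h1 := hσ ((k : ℕ) - (i : ℕ) : ℤ)
  have h2 := hσ (-((i : ℕ) + 1) : ℤ)
  have h3 := hσ ((k : ℕ) + 1 : ℤ)
  push_cast at h1 h2 h3
  set x := w * (-((i : ℕ) + 1)) + t with hx
  set y := w * ((k : ℕ) + 1) + t with hy
  have key := sigma_schur L x y t β
  have e1 : w * ((k : ℕ) + 1 - ((i : ℕ) + 1)) + β + t = x + y - t + β := by rw [hx, hy]; ring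
  have e2 : w * ((k : ℕ) + 1 - ((i : ℕ) + 1)) + t = x + y - t := by rw [hx, hy]; ring
  have e3 : w * (0 - ((i : ℕ) + 1)) + β + t = x + β := by rw [hx]; ring
  have e4 : w * (0 - ((i : ℕ) + 1)) + t = x := by rw [hx]; ring
  have e5 : w * ((k : ℕ) + 1 - 0) + β + t = y + β := by rw [hy]; ring
  have e6 : w * ((k : ℕ) + 1 - 0) + t = y := by rw [hy]; ring
  have e7 : w * (0 - 0) + β + t = t + β := by ring
  have e8 : w * (0 - 0) + t = t := by ring
  have e9 : w * ((i : ℕ) + 1) = -(x - t) := by rw [hx]; ring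
  have e10 : w * ((i : ℕ) + 1) - t = -x := by rw [hx]; ring
  have e11 : w * ((k : ℕ) + 1) = y - t := by rw [hy]; ring
  have e12 : w * ((k : ℕ) - (i : ℕ)) + (β + t) + t = x + y + β := by rw [hx, hy]; ring
  have e13 : w * ((k : ℕ) - (i : ℕ)) + t = x + y - t := by rw [hx, hy]; ring
  rw [e13] at h1
  rw [e1, e2, e3, e4, e5, e6, e7, e8, e10, e9, e11, e12, e13, sigma_neg, sigma_neg, add_comm β t]
  rw [add_comm β t] at hσtβ
  field_simp
  linear_combination key

lemma continuous_mul_sigmaToeplitz (w t : ℂ) (n : ℕ) :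
    Continuous fun β => Matrix.det (Matrix.of fun i k : Fin n =>
      sigma L (w * ((k : ℕ) - (i : ℕ)) + β + t) / sigma L (w * ((k : ℕ) - (i : ℕ)) + t)) := by
  have := continuous_sigma L
  refine Continuous.matrix_det (continuous_matrix fun i k => ?_)
  simp only [Matrix.of_apply]
  fun_prop

lemma sigmaToeplitz_mul_pow {w t β : ℂ} (hβ : β ∉ L.lattice) (n : ℕ) :
    sigmaToeplitz L w t β n * sigma L β ^ n = Matrix.det (Matrix.of fun i k : Fin n =>
      sigma L (w * ((k : ℕ) - (i : ℕ)) + β + t) / sigma L (w * ((k : ℕ) - (i : ℕ)) + t)) := by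
  have hσβ := sigma_ne_zero L hβ
  have h := Matrix.det_smul (Matrix.of fun i k : Fin n =>
    sigma L (w * ((k : ℕ) - (i : ℕ)) + β + t) /
      (sigma L (w * ((k : ℕ) - (i : ℕ)) + t) * sigma L β)) (sigma L β)
  rw [Fintype.card_fin, mul_comm] at h
  rw [sigmaToeplitz, ← h]
  congr 1
  ext i k
  simp only [Matrix.smul_apply, Matrix.of_apply, smul_eq_mul]
  field_simp

/-- Induction through `sigmaToeplitz_succ` moves `β` to `β + t`, so every translate `β + j * t` has
to avoid the lattice for the pivots to be nonzero. -/
lemma sigmaToeplitz_eq_of_generic {w t : ℂ} (ht : ∀ m : ℤ, t + m * w ∉ L.lattice) (n : ℕ) :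
    ∀ β : ℂ, (∀ j : ℕ, β + j * t ∉ L.lattice) →
    sigmaToeplitz L w t β n = sigma L (n * t + β) / sigma L β *
      ∏ k ∈ Finset.range n, ((∏ m ∈ Finset.range k, schurFactor L w t m) / sigma L t) := by
  induction n with
  | zero =>
    intro β hβ
    have := sigma_ne_zero L (hβ 0)
    simp_all [sigmaToeplitz]
  | succ n ih =>
    intro β hβ
    have h0 : β ∉ L.lattice := by simpa using hβ 0
    have h1 : β + t ∉ L.lattice := by simpa using hβ 1
    have h2 : ∀ j : ℕ, β + t + j * t ∉ L.lattice := fun j => by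
      have h := hβ (j + 1)
      have e : β + t + j * t = β + ((j + 1 : ℕ) : ℂ) * t := by
        push_cast
        ring
      rwa [e]
    have e : (n : ℂ) * t + (β + t) = (n + 1) * t + β := by ring
    rw [sigmaToeplitz_succ L ht h0 h1, ih _ h2, Finset.prod_range_succ _ n, e]
    have := sigma_ne_zero L h0
    have := sigma_ne_zero L h1
    have : sigma L t ≠ 0 := by simpa using sigma_ne_zero_of_shift L ht 0
    push_cast
    field_simp

/-- The closed form of the Toeplitz determinants, an elliptic Cauchy determinant. -/
lemma sigmaToeplitz_eq {w t β : ℂ} (ht : ∀ m : ℤ, t + m * w ∉ L.lattice) (hβ : β ∉ L.lattice)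
    (n : ℕ) :
    sigmaToeplitz L w t β n = sigma L (n * t + β) / sigma L β *
      ∏ k ∈ Finset.range n, ((∏ m ∈ Finset.range k, schurFactor L w t m) / sigma L t) := by
  have hσβ := sigma_ne_zero L hβ
  -- Size zero is separated so that clearing `σ(β)` from the closed form leaves the natural power
  -- `σ(β) ^ n`, continuous in `β`; density of the generic `β` then finishes.
  rcases n with - | n
  · simp [sigmaToeplitz, hσβ]
  set K := ∏ k ∈ Finset.range (n + 1), ((∏ m ∈ Finset.range k, schurFactor L w t m) / sigma L t)
  have hdense : Dense {β : ℂ | ∀ j : ℕ, β + j * t ∉ L.lattice} := by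
    refine ((Set.countable_iUnion fun j : ℕ =>
      (countable_lattice L).preimage (add_left_injective ((j : ℂ) * t))).dense_compl ℝ).mono
      fun z hz => ?_
    simpa using hz
  have hσ := continuous_sigma L
  have key := congr_fun (Continuous.ext_on hdense (continuous_mul_sigmaToeplitz L w t (n + 1))
    (g := fun β => sigma L (((n + 1 : ℕ) : ℂ) * t + β) * sigma L β ^ n * K)
    (by fun_prop) fun β' hβ' => ?_) β
  · rw [← sigmaToeplitz_mul_pow L hβ] at key
    refine mul_right_cancel₀ (pow_ne_zero (n + 1) hσβ) (key.trans ?_)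
    field_simp
    ring
  · have h0 : β' ∉ L.lattice := by simpa using hβ' 0
    have := sigma_ne_zero L h0
    dsimp only
    rw [← sigmaToeplitz_mul_pow L h0, sigmaToeplitz_eq_of_generic L ht _ _ hβ']
    change _ / _ * K * _ = _
    field_simp
    ring

/-- The exponential splits into row and column factors, whose `w`-parts cancel in the product over
all rows and columns. -/
lemma toeplitz_ellMoment_zero (w β γ t : ℂ) (n : ℕ) :
    toeplitz (ellMoment L w β γ t) 0 n = Complex.exp (γ * t) ^ n * sigmaToeplitz L w t β n := by
  have h : toeplitz (ellMoment L w β γ t) 0 n =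
      (∏ i : Fin n, Complex.exp (-(γ * w * (i : ℕ)))) *
      ((∏ k : Fin n, Complex.exp (γ * w * (k : ℕ) + γ * t)) * sigmaToeplitz L w t β n) := by
    rw [sigmaToeplitz, ← Matrix.det_mul_row, ← Matrix.det_mul_column, toeplitz]
    congr 1
    ext i k
    simp only [Matrix.of_apply, ellMoment, zero_add, Int.cast_sub, Int.cast_natCast]
    rw [← mul_assoc, ← Complex.exp_add]
    congr 2
    ring
  rw [h, ← mul_assoc, ← Finset.prod_mul_distrib]
  congr 1
  simp only [← Complex.exp_add, neg_add_cancel_left]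
  simp

lemma toeplitz_ellMoment_eq {w β t : ℂ} (γ : ℂ) (ht : ∀ m : ℤ, t + m * w ∉ L.lattice)
    (hβ : β ∉ L.lattice) (n : ℕ) :
    toeplitz (ellMoment L w β γ t) 0 n = sigma L (n * t + β) / sigma L β *
      ∏ k ∈ Finset.range n,
        (Complex.exp (γ * t) / sigma L t * ∏ m ∈ Finset.range k, schurFactor L w t m) := by
  rw [toeplitz_ellMoment_zero, sigmaToeplitz_eq L ht hβ, mul_left_comm]
  congr 1
  rw [← Finset.card_range n, ← Finset.prod_const, Finset.card_range, ← Finset.prod_mul_distrib]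
  refine Finset.prod_congr rfl fun k _ => ?_
  ring

lemma schurFactor_ne_zero {w t : ℂ} (hw : ∀ m : ℤ, m ≠ 0 → w * m ∉ L.lattice)
    (ht : ∀ m : ℤ, t + m * w ∉ L.lattice) (m : ℕ) : schurFactor L w t m ≠ 0 := by
  have h1 := sigma_ne_zero L (hw (m + 1) (by positivity))
  have h2 := sigma_ne_zero_of_shift L ht (m + 1)
  have h3 := sigma_ne_zero_of_shift L ht (-(m + 1))
  have e : w * ((-(m + 1) : ℤ) : ℂ) + t = -(w * (m + 1) - t) := by push_cast; ring
  rw [e, sigma_neg, neg_ne_zero] at h3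
  push_cast at h1 h2
  exact div_ne_zero (pow_ne_zero _ h1) (mul_ne_zero h2 h3)

lemma prod_schurFactor_ne_zero {w t : ℂ} (γ : ℂ) (hw : ∀ m : ℤ, m ≠ 0 → w * m ∉ L.lattice)
    (ht : ∀ m : ℤ, t + m * w ∉ L.lattice) (n : ℕ) :
    ∏ k ∈ Finset.range n,
      (Complex.exp (γ * t) / sigma L t * ∏ m ∈ Finset.range k, schurFactor L w t m) ≠ 0 :=
  have hσt : sigma L t ≠ 0 := by simpa using sigma_ne_zero_of_shift L ht 0
  Finset.prod_ne_zero_iff.2 fun _ _ => mul_ne_zero (div_ne_zero (Complex.exp_ne_zero _) hσt)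
    (Finset.prod_ne_zero_iff.2 fun m _ => schurFactor_ne_zero L hw ht m)

lemma toeplitz_ellMoment_ne_zero_iff {w β t : ℂ} (γ : ℂ) (hw : ∀ m : ℤ, m ≠ 0 → w * m ∉ L.lattice)
    (ht : ∀ m : ℤ, t + m * w ∉ L.lattice) (hβ : β ∉ L.lattice) (n : ℕ) :
    toeplitz (ellMoment L w β γ t) 0 n ≠ 0 ↔ n * t + β ∉ L.lattice := by
  have hprod := prod_schurFactor_ne_zero L γ hw ht n
  rw [toeplitz_ellMoment_eq L γ ht hβ, Ne, mul_eq_zero, or_iff_left hprod, div_eq_zero_iff,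
    or_iff_left (sigma_ne_zero L hβ), sigma_eq_zero_iff]

lemma hNorm_ellMoment_zero {w β t : ℂ} (γ : ℂ) (hw : ∀ m : ℤ, m ≠ 0 → w * m ∉ L.lattice)
    (ht : ∀ m : ℤ, t + m * w ∉ L.lattice) (hβ : β ∉ L.lattice) (n : ℕ) :
    hNorm (ellMoment L w β γ t) 0 n = Complex.exp (γ * t) / sigma L t *
      (sigma L (t * (n + 1) + β) / sigma L (t * n + β)) *
      ∏ m ∈ Finset.range n, schurFactor L w t m := by
  have hσt : sigma L t ≠ 0 := by simpa using sigma_ne_zero_of_shift L ht 0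
  have hprod := prod_schurFactor_ne_zero L γ hw ht n
  have hσβ := sigma_ne_zero L hβ
  rw [hNorm, toeplitz_ellMoment_eq L γ ht hβ, toeplitz_ellMoment_eq L γ ht hβ,
    Finset.prod_range_succ]
  push_cast
  rw [mul_comm t, mul_comm t]
  generalize (∏ k ∈ Finset.range n,
      (Complex.exp (γ * t) / sigma L t * ∏ m ∈ Finset.range k, schurFactor L w t m)) = K at *
  -- If the smaller determinant vanishes, both sides are `0` by the convention for division by zero.
  by_cases h0 : sigma L (n * t + β) = 0
  · simp [h0]
  field_simp

end Determinant

/-! ### Laurent biorthogonal polynomials of a general moment sequence -/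

section Biorthogonal

/-- The linear functional on polynomials with `z ^ k ↦ c (k + m)`. -/
noncomputable def momentFun (c : ℤ → ℂ) (m : ℤ) : ℂ[X] →ₗ[ℂ] ℂ :=
  Polynomial.lsum fun k => c (k + m) • LinearMap.id

lemma momentFun_C_mul_X_pow (c : ℤ → ℂ) (m : ℤ) (a : ℂ) (k : ℕ) :
    momentFun c m (C a * X ^ k) = a * c (k + m) := by
  rw [C_mul_X_pow_eq_monomial, momentFun, lsum_apply, sum_monomial_index _ _ (by simp)]
  simp [mul_comm a]

lemma momentFun_C_mul (c : ℤ → ℂ) (m : ℤ) (a : ℂ) (p : ℂ[X]) :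
    momentFun c m (C a * p) = a * momentFun c m p := by
  rw [C_mul', map_smul, smul_eq_mul]

lemma momentFun_eq_sum (c : ℤ → ℂ) (m : ℤ) {p : ℂ[X]} {n : ℕ} (hp : p.natDegree < n) :
    momentFun c m p = ∑ k : Fin n, p.coeff k * c ((k : ℕ) + m) := by
  rw [Fin.sum_univ_eq_sum_range fun k => p.coeff k * c (k + m)]
  conv_lhs => rw [p.as_sum_range' n hp, map_sum]
  simp [← C_mul_X_pow_eq_monomial, momentFun_C_mul_X_pow]

lemma momentFun_X_mul (c : ℤ → ℂ) (m : ℤ) (p : ℂ[X]) :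
    momentFun c m (X * p) = momentFun c (m + 1) p := by
  induction p using Polynomial.induction_on' with
  | add p q hp hq => rw [mul_add, map_add, map_add, hp, hq]
  | monomial k a =>
    rw [← C_mul_X_pow_eq_monomial, mul_left_comm, ← pow_succ', momentFun_C_mul_X_pow,
      momentFun_C_mul_X_pow]
    congr 2
    push_cast
    ring

lemma momentFun_shift (c : ℤ → ℂ) (m : ℤ) (p : ℂ[X]) :
    momentFun (fun k => c (k + 1)) m p = momentFun c (m + 1) p := by
  simp only [momentFun, add_assoc]

lemma toeplitz_shift (c : ℤ → ℂ) (s j : ℤ) (n : ℕ) :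
    toeplitz (fun k => c (k + s)) j n = toeplitz c (j + s) n := by
  unfold toeplitz
  congr 2
  ext i k
  simp only
  congr 1
  ring

lemma hNorm_shift (c : ℤ → ℂ) (s j : ℤ) (n : ℕ) :
    hNorm (fun k => c (k + s)) j n = hNorm c (j + s) n := by
  rw [hNorm, hNorm, toeplitz_shift, toeplitz_shift]

/-- Expansion along the last row of a Toeplitz matrix whose last row has been replaced. -/
lemma det_toeplitz_lastRow {R : Type*} [CommRing R] (c : ℤ → R) (n : ℕ) (v : Fin (n + 1) → R) :
    Matrix.det (Matrix.of fun i k : Fin (n + 1) =>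
      if (i : ℕ) < n then c (((k : ℕ) : ℤ) - ((i : ℕ) : ℤ)) else v k) =
    ∑ k : Fin (n + 1), (-1) ^ (n + (k : ℕ)) * v k *
      Matrix.det (Matrix.of fun i j : Fin n => c (((k.succAbove j : ℕ) : ℤ) - ((i : ℕ) : ℤ))) := by
  rw [Matrix.det_succ_row _ (Fin.last n)]
  refine Finset.sum_congr rfl fun k _ => ?_
  congr 1
  · simp
  · congr 1
    ext i j
    simp

/-- The minors of the first `n` rows. -/
noncomputable def lbpMinor (c : ℤ → ℂ) (n : ℕ) (k : Fin (n + 1)) : ℂ :=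
  Matrix.det (Matrix.of fun i j : Fin n => c (((k.succAbove j : ℕ) : ℤ) - ((i : ℕ) : ℤ)))

lemma lbp_eq_sum (c : ℤ → ℂ) (n : ℕ) :
    lbp c n = C (toeplitz c 0 n)⁻¹ * ∑ k : Fin (n + 1),
      C ((-1) ^ (n + (k : ℕ)) * lbpMinor c n k) * X ^ (k : ℕ) := by
  rw [lbp, det_toeplitz_lastRow (fun m => C (c m))]
  congr 1
  refine Finset.sum_congr rfl fun k _ => ?_
  rw [lbpMinor, map_mul, RingHom.map_det, map_pow, map_neg, map_one, mul_right_comm]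
  rfl

lemma lbpMinor_last (c : ℤ → ℂ) (n : ℕ) : lbpMinor c n (Fin.last n) = toeplitz c 0 n := by
  simp [lbpMinor, toeplitz]

lemma natDegree_lbp_le (c : ℤ → ℂ) (n : ℕ) : (lbp c n).natDegree ≤ n := by
  rw [lbp_eq_sum]
  refine (natDegree_C_mul_le _ _).trans (natDegree_sum_le_of_forall_le _ _ fun k _ => ?_)
  exact (natDegree_C_mul_X_pow_le _ _).trans (Nat.lt_succ_iff.1 k.2)

lemma coeff_lbp_self {c : ℤ → ℂ} {n : ℕ} (h : toeplitz c 0 n ≠ 0) : (lbp c n).coeff n = 1 := by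
  rw [lbp_eq_sum, coeff_C_mul, finsetSum_coeff, Finset.sum_eq_single (Fin.last n)]
  · simp [lbpMinor_last, h, ← two_mul]
  · intro k _ hk
    rw [coeff_C_mul_X_pow, if_neg]
    exact fun h' => hk (Fin.ext h'.symm)
  · simp

lemma lbp_zero (c : ℤ → ℂ) : lbp c 0 = 1 := by simp [lbp, toeplitz]

lemma momentFun_lbp (c : ℤ → ℂ) (m : ℤ) (n : ℕ) :
    momentFun c m (lbp c n) = (toeplitz c 0 n)⁻¹ * Matrix.det (Matrix.of fun i k : Fin (n + 1) =>
      if (i : ℕ) < n then c (((k : ℕ) : ℤ) - ((i : ℕ) : ℤ)) else c ((k : ℕ) + m)) := by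
  rw [lbp_eq_sum, momentFun_C_mul, map_sum, det_toeplitz_lastRow c n fun k => c ((k : ℕ) + m)]
  congr 1
  refine Finset.sum_congr rfl fun k _ => ?_
  rw [momentFun_C_mul_X_pow, lbpMinor]
  ring

/-- The functional replaces the last row by a copy of row `i`. -/
lemma momentFun_lbp_of_lt (c : ℤ → ℂ) {i n : ℕ} (hi : i < n) :
    momentFun c (-i) (lbp c n) = 0 := by
  rw [momentFun_lbp, Matrix.det_zero_of_row_eq (i := ⟨i, by omega⟩) (j := Fin.last n), mul_zero]
  · simp [Fin.ext_iff, hi.ne]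
  · ext k
    simp [hi, sub_eq_add_neg]

lemma momentFun_lbp_self (c : ℤ → ℂ) (n : ℕ) : momentFun c (-n) (lbp c n) = hNorm c 0 n := by
  rw [momentFun_lbp, hNorm, div_eq_inv_mul]
  congr 1
  unfold toeplitz
  congr 2
  ext i k
  split_ifs with h
  · simp
  · have : (i : ℕ) = n := by omega
    simp [this, sub_eq_add_neg]

/-- The vanishing moments say that the coefficient vector lies in the kernel of an invertible
Toeplitz matrix. Identities between the polynomials are proved by this uniqueness. -/
lemma eq_zero_of_momentFun_eq_zero {c : ℤ → ℂ} {n : ℕ} (h : toeplitz c 0 n ≠ 0) {p : ℂ[X]}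
    (hp : p.degree < n) (hm : ∀ i < n, momentFun c (-i) p = 0) : p = 0 := by
  by_contra hp0
  have hn : p.natDegree < n := (natDegree_lt_iff_degree_lt hp0).2 hp
  unfold toeplitz at h
  have hv := Matrix.eq_zero_of_mulVec_eq_zero h (v := fun k : Fin n => p.coeff k) (by
    ext i
    have := hm i i.2
    rw [momentFun_eq_sum c _ hn] at this
    rw [Pi.zero_apply, ← this, Matrix.mulVec, dotProduct]
    refine Finset.sum_congr rfl fun k _ => ?_
    rw [Matrix.of_apply, mul_comm, zero_add, sub_eq_add_neg])
  exact hp0 (leadingCoeff_eq_zero.1 (congr_fun hv ⟨p.natDegree, hn⟩))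

lemma degree_lt_of_coeff_eq_zero {p : ℂ[X]} {n : ℕ} (hp : p.natDegree ≤ n) (h : p.coeff n = 0) :
    p.degree < n := by
  rw [degree_lt_iff_coeff_zero]
  intro m hm
  rcases hm.eq_or_lt with rfl | hm
  · exact h
  · exact coeff_eq_zero_of_natDegree_lt (hp.trans_lt hm)

/-! ### Shift relations and the three-term recurrence -/

section Recurrence

variable {c : ℤ → ℂ}

lemma hNorm_zero_ne_zero (h0 : ∀ n, toeplitz c 0 n ≠ 0)
    (n : ℕ) : hNorm c 0 n ≠ 0 := div_ne_zero (h0 _) (h0 _)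

lemma recB_succ (h0 : ∀ n, toeplitz c 0 n ≠ 0)
    (n : ℕ) : recB c (n + 1) = hNorm c 1 (n + 1) / hNorm c 0 n := by
  rw [recB, recD, div_mul_cancel₀ _ (hNorm_zero_ne_zero h0 _)]

lemma hNorm_one_ne_zero (h1 : ∀ n, toeplitz c 1 n ≠ 0)
    (n : ℕ) : hNorm c 1 n ≠ 0 := div_ne_zero (h1 _) (h1 _)

lemma recD_ne_zero
    (h0 : ∀ n, toeplitz c 0 n ≠ 0) (h1 : ∀ n, toeplitz c 1 n ≠ 0)
    (n : ℕ) : recD c n ≠ 0 :=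
  div_ne_zero (hNorm_one_ne_zero h1 n) (hNorm_zero_ne_zero h0 n)

lemma recB_succ_ne_zero
    (h0 : ∀ n, toeplitz c 0 n ≠ 0) (h1 : ∀ n, toeplitz c 1 n ≠ 0)
    (n : ℕ) : recB c (n + 1) ≠ 0 := by
  rw [recB_succ h0]
  exact div_ne_zero (hNorm_one_ne_zero h1 _) (hNorm_zero_ne_zero h0 n)

lemma coeff_lbp_shift_self (h1 : ∀ n, toeplitz c 1 n ≠ 0)
    (n : ℕ) : (lbp (fun k => c (k + 1)) n).coeff n = 1 := by
  refine coeff_lbp_self ?_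
  rw [toeplitz_shift]
  exact h1 n

/-- The Christoffel-type relation `z P̃_n = P_{n+1} + d_n P_n` for the shifted moments. -/
lemma X_mul_lbp_shift
    (h0 : ∀ n, toeplitz c 0 n ≠ 0) (h1 : ∀ n, toeplitz c 1 n ≠ 0)
    (n : ℕ) :
    X * lbp (fun k => c (k + 1)) n = lbp c (n + 1) + C (recD c n) * lbp c n := by
  have key : lbp c (n + 1) + C (recD c n) * lbp c n - X * lbp (fun k => c (k + 1)) n = 0 := by
    refine eq_zero_of_momentFun_eq_zero (h0 (n + 1))
      (degree_lt_of_coeff_eq_zero ?_ ?_) fun i hi => ?_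
    · refine (natDegree_sub_le _ _).trans (max_le (natDegree_add_le_of_degree_le
        (natDegree_lbp_le c _) ?_) ?_)
      · exact (natDegree_C_mul_le _ _).trans ((natDegree_lbp_le c n).trans (Nat.le_succ n))
      · refine natDegree_mul_le.trans ?_
        rw [natDegree_X, add_comm]
        exact Nat.succ_le_succ (natDegree_lbp_le _ n)
    · rw [coeff_sub, coeff_add, coeff_X_mul, coeff_lbp_self (h0 _), coeff_C_mul,
        coeff_eq_zero_of_natDegree_lt ((natDegree_lbp_le c n).trans_lt (Nat.lt_succ_self n)),
        coeff_lbp_shift_self h1]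
      ring
    · rw [map_sub, map_add, momentFun_C_mul, momentFun_X_mul, ← momentFun_shift,
        momentFun_lbp_of_lt c hi]
      -- Only the moment with `i = n` is not automatic; it is what forces the value of `recD`.
      rcases (Nat.lt_succ_iff.1 hi).eq_or_lt with rfl | hi'
      · rw [momentFun_lbp_self, momentFun_lbp_self, hNorm_shift, recD, zero_add, zero_add,
          div_mul_cancel₀ _ (hNorm_zero_ne_zero h0 _), sub_self]
      · rw [momentFun_lbp_of_lt c hi', momentFun_lbp_of_lt _ hi']
        ring
  rw [sub_eq_zero] at key
  exact key.symm

/-- The relation `P̃_n = P_n + b_n P_{n-1}` for the shifted moments. -/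
lemma lbp_shift_succ
    (h0 : ∀ n, toeplitz c 0 n ≠ 0) (h1 : ∀ n, toeplitz c 1 n ≠ 0)
    (n : ℕ) :
    lbp (fun k => c (k + 1)) (n + 1) = lbp c (n + 1) + C (recB c (n + 1)) * lbp c n := by
  have key : lbp (fun k => c (k + 1)) (n + 1) - lbp c (n + 1) - C (recB c (n + 1)) * lbp c n
      = 0 := by
    refine eq_zero_of_momentFun_eq_zero (h0 (n + 1))
      (degree_lt_of_coeff_eq_zero ?_ ?_) fun i hi => ?_
    · refine (natDegree_sub_le _ _).trans (max_le ((natDegree_sub_le _ _).trans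
        (max_le (natDegree_lbp_le _ _) (natDegree_lbp_le _ _))) ?_)
      exact (natDegree_C_mul_le _ _).trans ((natDegree_lbp_le c n).trans (Nat.le_succ n))
    · rw [coeff_sub, coeff_sub, coeff_lbp_self (h0 _), coeff_C_mul,
        coeff_eq_zero_of_natDegree_lt ((natDegree_lbp_le c n).trans_lt (Nat.lt_succ_self n)),
        coeff_lbp_shift_self h1]
      ring
    -- Passing to the shifted functional raises `i` by one, so at `i = n` the shifted polynomial of
    -- degree `n + 1` contributes its norm, which fixes `recB`.
    · have e : (-(i : ℤ)) = -((i + 1 : ℕ) : ℤ) + 1 := by push_cast; ring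
      rw [map_sub, map_sub, momentFun_C_mul, momentFun_lbp_of_lt c hi]
      conv_lhs => enter [1, 1]; rw [e, ← momentFun_shift]
      rcases (Nat.lt_succ_iff.1 hi).eq_or_lt with rfl | hi'
      · rw [momentFun_lbp_self, momentFun_lbp_self, hNorm_shift, recB_succ h0, zero_add,
          div_mul_cancel₀ _ (hNorm_zero_ne_zero h0 _)]
        ring
      · rw [momentFun_lbp_of_lt c hi', momentFun_lbp_of_lt _ (Nat.succ_lt_succ hi')]
        ring
  linear_combination key

lemma lbp_recurrence_zero
    (h0 : ∀ n, toeplitz c 0 n ≠ 0) (h1 : ∀ n, toeplitz c 1 n ≠ 0) :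
    lbp c 1 + (C (recD c 0) - X) * lbp c 0 = 0 := by
  have h := X_mul_lbp_shift h0 h1 0
  rw [lbp_zero] at h
  rw [lbp_zero] at h ⊢
  linear_combination -h

lemma lbp_recurrence
    (h0 : ∀ n, toeplitz c 0 n ≠ 0) (h1 : ∀ n, toeplitz c 1 n ≠ 0)
    (n : ℕ) :
    lbp c (n + 2) + (C (recD c (n + 1)) - X) * lbp c (n + 1)
      = X * C (recB c (n + 1)) * lbp c n := by
  have hA := X_mul_lbp_shift h0 h1 (n + 1)
  have hB := lbp_shift_succ h0 h1 n
  linear_combination X * hB - hA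

lemma eval_zero_lbp_succ (h0 : ∀ n, toeplitz c 0 n ≠ 0) (h1 : ∀ n, toeplitz c 1 n ≠ 0) (n : ℕ) :
    (lbp c (n + 1)).eval 0 = -(recD c n * (lbp c n).eval 0) := by
  have h := congr_arg (eval 0) (X_mul_lbp_shift h0 h1 n)
  simp only [eval_mul, eval_X, zero_mul, eval_add, eval_C] at h
  linear_combination -h

lemma eval_zero_lbp_ne_zero (h0 : ∀ n, toeplitz c 0 n ≠ 0) (h1 : ∀ n, toeplitz c 1 n ≠ 0)
    (n : ℕ) : (lbp c n).eval 0 ≠ 0 := by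
  induction n with
  | zero => simp [lbp_zero]
  | succ n ih =>
    rw [eval_zero_lbp_succ h0 h1, neg_ne_zero]
    exact mul_ne_zero (recD_ne_zero h0 h1 n) ih

lemma recD_eq_neg_eval_div (h0 : ∀ n, toeplitz c 0 n ≠ 0) (h1 : ∀ n, toeplitz c 1 n ≠ 0)
    (n : ℕ) : recD c n = -((lbp c (n + 1)).eval 0 / (lbp c n).eval 0) := by
  have := eval_zero_lbp_ne_zero h0 h1 n
  rw [eval_zero_lbp_succ h0 h1]
  field_simp

lemma lbp_recurrence_zero_iff (h0 : ∀ n, toeplitz c 0 n ≠ 0) (h1 : ∀ n, toeplitz c 1 n ≠ 0)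
    (d : ℂ) : lbp c 1 + (C d - X) * lbp c 0 = 0 ↔ d = recD c 0 := by
  have h := lbp_recurrence_zero h0 h1
  refine ⟨fun hd => ?_, fun hd => hd ▸ h⟩
  rw [lbp_zero] at h hd
  have : C d = C (recD c 0) := by linear_combination hd - h
  exact C_injective this

/-- Evaluation at `0` kills the right side and isolates `d`, since these polynomials do not vanish
at `0`; then `b` is found by cancelling `X * lbp c n`. -/
lemma lbp_recurrence_iff (h0 : ∀ n, toeplitz c 0 n ≠ 0) (h1 : ∀ n, toeplitz c 1 n ≠ 0)
    (n : ℕ) (d b : ℂ) :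
    lbp c (n + 2) + (C d - X) * lbp c (n + 1) = X * C b * lbp c n ↔
      d = recD c (n + 1) ∧ b = recB c (n + 1) := by
  have h := lbp_recurrence h0 h1 n
  refine ⟨fun hdb => ?_, fun ⟨hd, hb⟩ => hd ▸ hb ▸ h⟩
  have hd : d = recD c (n + 1) := by
    have e := congr_arg (eval 0) (congr_arg₂ (· - ·) hdb h)
    simp only [eval_sub, eval_add, eval_mul, eval_C, eval_X, zero_mul, sub_zero] at e
    refine mul_right_cancel₀ (eval_zero_lbp_ne_zero h0 h1 (n + 1)) ?_
    linear_combination e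
  refine ⟨hd, ?_⟩
  subst hd
  have hP : X * lbp c n ≠ 0 := mul_ne_zero X_ne_zero fun hz =>
    eval_zero_lbp_ne_zero h0 h1 n (by rw [hz, eval_zero])
  refine C_injective (mul_right_cancel₀ hP ?_)
  linear_combination h - hdb

end Recurrence

end Biorthogonal

/-! ### From the two-point `QD`-algorithm to the Toda chain and the ordinary `QD`-algorithm -/

section QD

variable {b d : ℤ → ℕ → ℂ}

/-- For `n = 0` the difference is minus the next `d`. If it vanished at `n + 1`, the additive rule
would make `b` and `d` equal at time `j + 1`, and the multiplicative rule would push the vanishing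
down to `n`. -/
lemma IsTwoPointQD.den_ne (h : IsTwoPointQD b d) (j : ℤ) (n : ℕ) :
    b j (n + 1) - d j n ≠ 0 := by
  induction n generalizing j with
  | zero =>
    rw [← h.add_rel, h.b_zero, zero_sub, neg_ne_zero]
    exact h.d_ne _ _
  | succ n ih =>
    intro h0
    have h1 := h.add_rel j (n + 1)
    have h2 := h.mul_rel j n
    refine mul_ne_zero (ih j) (h.d_ne (j + 1) (n + 1)) ?_
    linear_combination h2 + d j n * h1 + d j n * h0

lemma IsTwoPointQD.isDiscreteRelToda (h : IsTwoPointQD b d) : IsDiscreteRelToda b d where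
  b_zero := h.b_zero
  d_zero j := by
    have := h.add_rel j 0
    rw [h.b_zero] at this
    linear_combination -this
  den_ne := h.den_ne
  d_rel j n := by
    have h0 := h.den_ne j n
    have h1 := h.add_rel j (n + 1)
    have h2 := h.mul_rel j n
    field_simp
    linear_combination h2 + d j n * h1
  b_rel j n := by
    have h0 := h.den_ne j n
    have h1 := h.add_rel j (n + 1)
    have h2 := h.mul_rel j n
    field_simp
    linear_combination h2 + b j (n + 1) * h1

lemma IsTwoPointQD.isQD (h : IsTwoPointQD b d) {e f : ℤ → ℕ → ℂ}
    (he : ∀ j n, e j n = b (j + n) n - d (j + n) n) (hf : ∀ j n, f j n = b (j + n - 1) n) :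
    IsQD e f := by
  have i1 : ∀ (j : ℤ) (n : ℕ), j + 1 + n = j + n + 1 := fun j n => by ring
  have i2 : ∀ (j : ℤ) (n : ℕ), j + (n + 1 : ℕ) = j + n + 1 := fun j n => by push_cast; ring
  have i3 : ∀ j : ℤ, j + 1 - 1 = j := fun j => by ring
  refine ⟨fun j => ?_, fun j n => ?_, fun j n => ?_, fun j n => ?_, fun j n => ?_⟩
  · rw [hf, h.b_zero]
  · have h1 := h.add_rel (j + n - 1) n
    rw [sub_add_cancel] at h1
    rw [he, h1]
    exact h.den_ne _ _
  · rw [hf]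
    exact h.b_ne _ _
  · rw [he, he, hf, hf, i1, i2, i2, i1, i3, i3]
    have h1 := h.add_rel (j + n) n
    have h2 := h.mul_rel (j + n) n
    linear_combination b (j + n + 1) (n + 1) * h1 + h2
  · rw [he, he, hf, hf, i1, i2, i3]
    have h1 := h.add_rel (j + n) n
    linear_combination h1

variable {P : ℤ → ℕ → ℂ[X]}

/-- Expanding `X * P (j + 2) (n + 1)` in two ways in the polynomials at time `j` gives a linear
relation between `P j (n + 1)` and `P j n`. Being monic of different degrees, these have zero
coefficients there, which are the two `QD` rules. -/
lemma isTwoPointQD_of_relations (hP0 : ∀ j, P j 0 = 1) (hdeg : ∀ j n, (P j n).natDegree ≤ n)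
    (hcoeff : ∀ j n, (P j n).coeff n = 1)
    (hA : ∀ j n, X * P (j + 1) n = P j (n + 1) + C (d j n) * P j n)
    (hB : ∀ j n, P (j + 1) (n + 1) = P j (n + 1) + C (b j (n + 1)) * P j n)
    (hb0 : ∀ j, b j 0 = 0) (hd : ∀ j n, d j n ≠ 0) (hb : ∀ j n, b j (n + 1) ≠ 0) :
    IsTwoPointQD b d := by
  have key : ∀ j n, C (b j (n + 2) + d (j + 1) (n + 1) - d j (n + 1) - b (j + 1) (n + 1))
        * P j (n + 1)
      + C (b j (n + 1) * d (j + 1) (n + 1) - d j n * b (j + 1) (n + 1)) * P j n = 0 := by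
    intro j n
    have h1 := hA (j + 1) (n + 1)
    have h2 := hB (j + 1) n
    have h3 := hA j (n + 1)
    have h4 := hA j n
    have h5 := hB j (n + 1)
    have h6 := hB j n
    simp only [C_sub, C_add, C_mul]
    linear_combination -h1 + X * h2 + h3 + C (b (j + 1) (n + 1)) * h4 - h5
      - C (d (j + 1) (n + 1)) * h6
  have hadd : ∀ j n, b j (n + 2) + d (j + 1) (n + 1) - d j (n + 1) - b (j + 1) (n + 1) = 0 := by
    intro j n
    have h := congr_arg (fun p => coeff p (n + 1)) (key j n)
    simp only [coeff_add, coeff_C_mul, hcoeff, coeff_zero,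
      coeff_eq_zero_of_natDegree_lt ((hdeg j n).trans_lt (Nat.lt_succ_self n))] at h
    linear_combination h
  refine ⟨hb0, hd, hb, fun j n => ?_, fun j n => ?_⟩
  · have h := congr_arg (fun p => coeff p n) (key j n)
    simp only [hadd, C_0, zero_mul, zero_add, coeff_C_mul, hcoeff, coeff_zero] at h
    linear_combination h
  · rcases n with - | n
    · have h1 := hA j 0
      have h2 := hA (j + 1) 0
      have h3 := hB j 0
      simp only [hP0] at h1 h2 h3
      have h4 : C (b (j + 1) 0 - d (j + 1) 0) = C (b j 1 - d j 0) := by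
        simp only [hb0, C_sub, C_0]
        linear_combination h2 - h1 + h3
      exact C_injective h4
    · linear_combination -hadd j n

/-- The relations of the ordinary `QD` polynomials along the staircase `j + n`. -/
lemma staircase_relations (h : IsTwoPointQD b d) (hP0 : ∀ j, P j 0 = 1)
    (hA : ∀ j n, X * P (j + 1) n = P j (n + 1) + C (d j n) * P j n)
    (hB : ∀ j n, P (j + 1) (n + 1) = P j (n + 1) + C (b j (n + 1)) * P j n)
    {e f : ℤ → ℕ → ℂ} (he : ∀ j n, e j n = b (j + n) n - d (j + n) n)
    (hf : ∀ j n, f j n = b (j + n - 1) n) {W : ℤ → ℕ → ℂ[X]} (hW : ∀ j n, W j n = P (j + n) n) :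
    (∀ j n, W (j - 1) (n + 1) = W j (n + 1) - C (f j (n + 1)) * W j n) ∧
    (∀ j n, X * W (j + 1) n = W j (n + 1) - C (e (j + 1) n) * W j n) ∧
    (∀ j, W j 1 + C (-e j 0 - f j 1) * W j 0 = X * W j 0) ∧
    (∀ j n, W j (n + 2) + C (-e j (n + 1) - f j (n + 2)) * W j (n + 1) +
      C (e j (n + 1) * f j (n + 1)) * W j n = X * W j (n + 1)) := by
  have i0 : ∀ (j : ℤ) (n : ℕ), j - 1 + (n + 1 : ℕ) = j + n := fun j n => by push_cast; ring
  have i1 : ∀ (j : ℤ) (n : ℕ), j + 1 + n = j + n + 1 := fun j n => by ring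
  have i2 : ∀ (j : ℤ) (n : ℕ), j + (n + 1 : ℕ) = j + n + 1 := fun j n => by push_cast; ring
  have i3 : ∀ j : ℤ, j + 1 - 1 = j := fun j => by ring
  have h1 : ∀ j n, W (j - 1) (n + 1) = W j (n + 1) - C (f j (n + 1)) * W j n := by
    intro j n
    rw [hW, hW, hW, hf, i0, i2, i3]
    linear_combination -hB (j + n) n
  have h2 : ∀ j n, X * W (j + 1) n = W j (n + 1) - C (e (j + 1) n) * W j n := by
    intro j n
    -- The additive rule rewrites `e` with data at time `j + n`, where the relation is the
    -- difference of `hA` and `hB`.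
    rw [hW, hW, hW, he, i1, i2, h.add_rel, C_sub]
    linear_combination hA (j + n) n - hB (j + n) n
  refine ⟨h1, h2, fun j => ?_, fun j n => ?_⟩
  · have h3 := h1 (j + 1) 0
    have h4 := h2 j 0
    have h5 := hA j 0
    have h6 := hB j 0
    simp only [hW, he, hf, hP0, h.b_zero, Nat.cast_zero, add_zero, zero_add, Nat.cast_one, i3,
      C_sub, C_neg, C_0] at h5 h6 ⊢
    linear_combination h6 - h5
  · have h3 := h1 j (n + 1)
    have h4 := h2 (j - 1) (n + 1)
    have h5 := h1 j n
    rw [sub_add_cancel] at h4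
    simp only [C_sub, C_neg, C_mul]
    linear_combination -h3 - h4 + C (e j (n + 1)) * h5

end QD

/-! ### Closed forms for elliptic moments -/

section ClosedForms

variable (L : PeriodPair) {w t β : ℂ}

lemma prod_schurFactor_eq (hw : sigma L w ≠ 0) (n : ℕ) :
    ∏ m ∈ Finset.range n, schurFactor L w t m =
      ellFact L w n ^ 2 / (ellPoch L w (-(t / w) + 1) n * ellPoch L w (t / w + 1) n) := by
  have hw0 : w ≠ 0 := by
    rintro rfl
    exact hw (sigma_zero L)
  rw [ellFact, ellPoch, ellPoch, ellPoch, ← Finset.prod_pow, ← Finset.prod_mul_distrib,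
    ← Finset.prod_div_distrib]
  refine Finset.prod_congr rfl fun m _ => ?_
  have e1 : w * (1 + m) = w * (m + 1) := by ring
  have e2 : w * (-(t / w) + 1 + m) = w * (m + 1) - t := by field_simp; ring
  have e3 : w * (t / w + 1 + m) = w * (m + 1) + t := by field_simp; ring
  rw [schurFactor, ellNum, ellNum, ellNum, e1, e2, e3, div_pow, div_mul_div_comm, ← sq,
    div_div_div_cancel_right₀ (pow_ne_zero 2 hw), mul_comm (sigma L (_ + t))]

lemma ellD_eq (hw : sigma L w ≠ 0) (β γ : ℂ) (n : ℕ) (t : ℂ) :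
    ellD L w β γ n t = Complex.exp (γ * w) *
      ((sigma L (t - w * n) * sigma L (β + (t + w) * (n + 1)) * sigma L (β + t * n)) /
        (sigma L (t + w * (n + 1)) * sigma L (β + (t + w) * n) * sigma L (β + t * (n + 1)))) := by
  have hw0 : w ≠ 0 := by
    rintro rfl
    exact hw (sigma_zero L)
  have e1 : w * (t / w - n) = t - w * n := by field_simp
  have e2 : w * (β / w + (t / w + 1) * (n + 1)) = β + (t + w) * (n + 1) := by field_simp
  have e3 : w * (β / w + t / w * n) = β + t * n := by field_simp
  have e4 : w * (t / w + (n + 1)) = t + w * (n + 1) := by field_simp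
  have e5 : w * (β / w + (t / w + 1) * n) = β + (t + w) * n := by field_simp
  have e6 : w * (β / w + t / w * (n + 1)) = β + t * (n + 1) := by field_simp
  simp only [ellD, ellNum, e1, e2, e3, e4, e5, e6]
  rw [div_mul_div_comm, div_mul_div_comm, div_mul_div_comm, div_mul_div_comm,
    div_div_div_cancel_right₀ (mul_ne_zero (mul_ne_zero hw hw) hw)]

lemma ellB_zero (β γ t : ℂ) : ellB L w β γ 0 t = 0 := by
  simp [ellB, ellNum, sigma_zero]

lemma ellB_succ_eq (hw : sigma L w ≠ 0) (β γ : ℂ) (n : ℕ) (t : ℂ) :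
    ellB L w β γ (n + 1) t = -Complex.exp (γ * w) *
      ((sigma L (w * (n + 1)) ^ 2 * sigma L (β + (t + w) * (n + 2)) * sigma L (β + t * n)) /
        (sigma L (β + (t + w) * (n + 1)) * sigma L (β + t * (n + 1)) * sigma L (t + w * (n + 1)) *
          sigma L (t + w * (n + 2)))) := by
  have hw0 : w ≠ 0 := by
    rintro rfl
    exact hw (sigma_zero L)
  have e1 : w * ((n + 1 : ℕ) : ℂ) = w * (n + 1) := by push_cast; ring
  have e2 : w * (β / w + (t / w + 1) * (((n + 1 : ℕ) : ℂ) + 1)) = β + (t + w) * (n + 2) := by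
    push_cast
    field_simp
    ring
  have e3 : w * (β / w + t / w * (((n + 1 : ℕ) : ℂ) - 1)) = β + t * n := by
    push_cast
    field_simp
    ring
  have e4 : w * (β / w + (t / w + 1) * ((n + 1 : ℕ) : ℂ)) = β + (t + w) * (n + 1) := by
    push_cast
    field_simp
  have e5 : w * (β / w + t / w * ((n + 1 : ℕ) : ℂ)) = β + t * (n + 1) := by
    push_cast
    field_simp
  have e6 : w * (t / w + ((n + 1 : ℕ) : ℂ)) = t + w * (n + 1) := by
    push_cast
    field_simp
  have e7 : w * (t / w + ((n + 1 : ℕ) : ℂ) + 1) = t + w * (n + 2) := by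
    push_cast
    field_simp
    ring
  simp only [ellB, ellNum, e1, e2, e3, e4, e5, e6, e7]
  rw [div_pow, div_mul_div_comm, div_mul_div_comm, div_mul_div_comm, div_mul_div_comm,
    div_mul_div_comm]
  have e8 : sigma L w ^ 2 * sigma L w * sigma L w =
    sigma L w * sigma L w * sigma L w * sigma L w := by ring
  rw [e8, div_div_div_cancel_right₀ (mul_ne_zero (mul_ne_zero (mul_ne_zero hw hw) hw) hw)]

/-- Replacing `t` by `t + w` moves the denominators by one index, so the ratio of the products
telescopes to its end factors. -/
lemma prod_schurFactor_shift (ht : ∀ m : ℤ, t + m * w ∉ L.lattice) (n : ℕ) :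
    (∏ m ∈ Finset.range n, schurFactor L w (t + w) m) * sigma L (t + w * (n + 1)) * sigma L t =
      (∏ m ∈ Finset.range n, schurFactor L w t m) * sigma L (t + w) * sigma L (t - w * n) := by
  induction n with
  | zero => simp [mul_comm]
  | succ n ih =>
    have h1 := sigma_ne_zero_of_shift L ht (n + 1)
    have h2 := sigma_ne_zero_of_shift L ht (n + 2)
    have h3 : sigma L (w * (-((n : ℂ) + 1)) + t) ≠ 0 := by
      simpa only [Int.cast_neg, Int.cast_add, Int.cast_natCast, Int.cast_one] using
        sigma_ne_zero_of_shift L ht (-(n + 1))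
    have h4 := sigma_ne_zero_of_shift L ht (-n)
    rw [Finset.prod_range_succ, Finset.prod_range_succ, schurFactor, schurFactor]
    push_cast at h1 h2 h4 ⊢
    have e1 : w * (n + 1) + (t + w) = w * (n + 2) + t := by ring
    have e2 : w * (n + 1) - (t + w) = -(w * (-n) + t) := by ring
    have e3 : w * (n + 1) - t = -(w * (-(n + 1)) + t) := by ring
    have e4 : t + w * (n + 1 + 1) = w * (n + 2) + t := by ring
    have e5 : t - w * (n + 1) = w * (-(n + 1)) + t := by ring
    have e6 : t + w * (n + 1) = w * (n + 1) + t := by ring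
    have e7 : t - w * n = w * (-n) + t := by ring
    rw [e6, e7] at ih
    rw [e1, e2, e3, e4, e5, sigma_neg, sigma_neg]
    generalize ∏ m ∈ Finset.range n, schurFactor L w (t + w) m = A at *
    generalize ∏ m ∈ Finset.range n, schurFactor L w t m = B at *
    generalize sigma L (w * (n + 2) + t) = s₂ at *
    generalize sigma L (w * -n + t) = s₄ at *
    generalize sigma L (w * (-(n + 1)) + t) = s₃ at *
    generalize sigma L (w * (n + 1) + t) = s₁ at *
    field_simp
    linear_combination -sigma L (w * (n + 1)) ^ 2 * ih

lemma ellMoment_shift (w β γ t : ℂ) (j : ℤ) :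
    ellMoment L w β γ (t + j * w) = fun k => ellMoment L w β γ t (k + j) := by
  ext k
  unfold ellMoment
  have e1 : γ * w * k + γ * (t + j * w) = γ * w * ((k + j : ℤ) : ℂ) + γ * t := by
    push_cast; ring
  have e2 : w * k + β + (t + j * w) = w * ((k + j : ℤ) : ℂ) + β + t := by push_cast; ring
  have e3 : w * k + (t + j * w) = w * ((k + j : ℤ) : ℂ) + t := by push_cast; ring
  rw [e1, e2, e3]

lemma toeplitz_ellMoment_shift (w β γ t : ℂ) (i j : ℤ) (n : ℕ) :
    toeplitz (ellMoment L w β γ (t + j * w)) i n = toeplitz (ellMoment L w β γ t) (i + j) n := by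
  rw [ellMoment_shift, toeplitz_shift]

lemma hNorm_ellMoment_one (w β γ t : ℂ) (n : ℕ) :
    hNorm (ellMoment L w β γ t) 1 n = hNorm (ellMoment L w β γ (t + w)) 0 n := by
  have h := ellMoment_shift L w β γ t 1
  rw [Int.cast_one, one_mul] at h
  rw [h, hNorm_shift, zero_add]

lemma shift_notMem_lattice (ht : ∀ m : ℤ, t + m * w ∉ L.lattice) (j m : ℤ) :
    t + j * w + m * w ∉ L.lattice := by
  have := ht (j + m)
  push_cast at this
  rwa [add_mul, ← add_assoc] at this

lemma shift_one_notMem_lattice (ht : ∀ m : ℤ, t + m * w ∉ L.lattice) (m : ℤ) :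
    t + w + m * w ∉ L.lattice := by
  simpa using shift_notMem_lattice L ht 1 m

lemma sigma_step_ne_zero (hw : ∀ m : ℤ, m ≠ 0 → w * m ∉ L.lattice) : sigma L w ≠ 0 := by
  simpa using sigma_ne_zero L (hw 1 one_ne_zero)

variable (γ : ℂ)

lemma hNorm_zero_eq_ellH (hw : ∀ m : ℤ, m ≠ 0 → w * m ∉ L.lattice)
    (ht : ∀ m : ℤ, t + m * w ∉ L.lattice) (hβ : β ∉ L.lattice) (n : ℕ) :
    hNorm (ellMoment L w β γ t) 0 n = ellH L w β γ n t := by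
  rw [hNorm_ellMoment_zero L γ hw ht hβ, prod_schurFactor_eq L (sigma_step_ne_zero L hw), ellH]

lemma hNorm_one_eq_ellH1 (hw : ∀ m : ℤ, m ≠ 0 → w * m ∉ L.lattice)
    (ht : ∀ m : ℤ, t + m * w ∉ L.lattice) (hβ : β ∉ L.lattice) (n : ℕ) :
    hNorm (ellMoment L w β γ t) 1 n = ellH1 L w β γ n t := by
  have hσ := sigma_step_ne_zero L hw
  have hw0 : w ≠ 0 := by
    rintro rfl
    exact hσ (sigma_zero L)
  rw [hNorm_ellMoment_one, hNorm_zero_eq_ellH L γ hw (shift_one_notMem_lattice L ht) hβ, ellH,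
    ellH1]
  have e1 : -((t + w) / w) + 1 = -(t / w) := by field_simp; ring
  have e2 : (t + w) / w + 1 = t / w + 2 := by field_simp; ring
  rw [e1, e2]

lemma recD_eq_ellD (hw : ∀ m : ℤ, m ≠ 0 → w * m ∉ L.lattice)
    (ht : ∀ m : ℤ, t + m * w ∉ L.lattice) (hβ : β ∉ L.lattice)
    (h0 : ∀ n, toeplitz (ellMoment L w β γ t) 0 n ≠ 0) (n : ℕ) :
    recD (ellMoment L w β γ t) n = ellD L w β γ n t := by
  have ht' := shift_one_notMem_lattice L ht
  have hs1 : sigma L t ≠ 0 := by simpa using sigma_ne_zero_of_shift L ht 0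
  have hs2 : sigma L (t + w) ≠ 0 := by simpa using sigma_ne_zero_of_shift L ht' 0
  have hs3 := sigma_ne_zero_of_shift L ht (n + 1)
  push_cast at hs3
  rw [add_comm] at hs3
  have hn := fun n => sigma_ne_zero L ((toeplitz_ellMoment_ne_zero_iff L γ hw ht hβ n).1 (h0 n))
  have hs4 := hn n
  have hs5 := hn (n + 1)
  push_cast at hs5
  rw [mul_comm, add_comm] at hs4 hs5
  have hprod : ∏ m ∈ Finset.range n, schurFactor L w t m ≠ 0 :=
    Finset.prod_ne_zero_iff.2 fun m _ => schurFactor_ne_zero L hw ht m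
  have key := prod_schurFactor_shift L ht n
  have hexp : Complex.exp (γ * (t + w)) = Complex.exp (γ * w) * Complex.exp (γ * t) := by
    rw [← Complex.exp_add]
    congr 1
    ring
  have hne := Complex.exp_ne_zero (γ * t)
  rw [recD, hNorm_ellMoment_one, hNorm_ellMoment_zero L γ hw ht hβ,
    hNorm_ellMoment_zero L γ hw ht' hβ, ellD_eq L (sigma_step_ne_zero L hw), hexp,
    add_comm _ β, add_comm _ β, add_comm _ β, add_comm _ β]
  generalize ∏ m ∈ Finset.range n, schurFactor L w (t + w) m = A at *
  generalize ∏ m ∈ Finset.range n, schurFactor L w t m = B at *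
  have hA : A = B * sigma L (t + w) * sigma L (t - w * n) /
      (sigma L (t + w * (n + 1)) * sigma L t) := by
    rw [eq_div_iff (mul_ne_zero hs3 hs1), ← key]
    ring
  rw [hA]
  -- The shifted determinants are not assumed nonzero; when this one vanishes, both sides are `0`
  -- through division by zero.
  by_cases h6 : sigma L (β + (t + w) * n) = 0
  · simp [h6]
  field_simp

lemma recB_eq_ellB (hw : ∀ m : ℤ, m ≠ 0 → w * m ∉ L.lattice)
    (ht : ∀ m : ℤ, t + m * w ∉ L.lattice) (hβ : β ∉ L.lattice)
    (h0 : ∀ n, toeplitz (ellMoment L w β γ t) 0 n ≠ 0) (n : ℕ) :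
    recB (ellMoment L w β γ t) n = ellB L w β γ n t := by
  rcases n with - | n
  · rw [recB, ellB_zero]
  have hs1 : sigma L t ≠ 0 := by simpa using sigma_ne_zero_of_shift L ht 0
  have hs2 := sigma_ne_zero_of_shift L ht (n + 2)
  have hs3 := sigma_ne_zero_of_shift L ht (n + 1)
  have hs7 := sigma_ne_zero_of_shift L ht (-(n + 1))
  push_cast at hs2 hs3
  rw [add_comm] at hs2 hs3
  have hn := fun n => sigma_ne_zero L ((toeplitz_ellMoment_ne_zero_iff L γ hw ht hβ n).1 (h0 n))
  have hs4 := hn n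
  have hs5 := hn (n + 1)
  have hs6 := hn (n + 2)
  push_cast at hs5 hs6
  rw [mul_comm, add_comm] at hs4 hs5 hs6
  have hprod : ∏ m ∈ Finset.range n, schurFactor L w t m ≠ 0 :=
    Finset.prod_ne_zero_iff.2 fun m _ => schurFactor_ne_zero L hw ht m
  have hne := Complex.exp_ne_zero (γ * t)
  have e1 : w * ((-(n + 1) : ℤ) : ℂ) + t = t - w * (n + 1) := by push_cast; ring
  have e2 : w * (n + 1) - t = -(t - w * (n + 1)) := by ring
  have e3 : (n : ℂ) + 1 + 1 = n + 2 := by ring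
  rw [e1] at hs7
  rw [recB, recD_eq_ellD L γ hw ht hβ h0, hNorm_ellMoment_zero L γ hw ht hβ,
    hNorm_ellMoment_zero L γ hw ht hβ, ellD_eq L (sigma_step_ne_zero L hw),
    ellB_succ_eq L (sigma_step_ne_zero L hw), Finset.prod_range_succ, schurFactor]
  push_cast
  rw [e2, sigma_neg, e3, add_comm _ β, add_comm _ β, add_comm _ β, add_comm (w * _) t]
  generalize ∏ m ∈ Finset.range n, schurFactor L w t m = B at *
  by_cases h8 : sigma L (β + (t + w) * (n + 1)) = 0
  · simp [h8]
  field_simp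

end ClosedForms

/-! ### Ellipticity in the time variable -/

section Elliptic

variable (L : PeriodPair) {w : ℂ}

/-- Each further step contributes `exp (η * s) = C ^ 2` once per earlier step, and the odd numbers
sum to `n ^ 2`. -/
lemma exists_sigma_add_nat_mul {s : ℂ} (hs : s ∈ L.lattice) :
    ∃ C η : ℂ, C ≠ 0 ∧ ∀ (n : ℕ) (u : ℂ),
      sigma L (u + n * s) = C ^ n ^ 2 * Complex.exp (n * (η * u)) * sigma L u := by
  obtain ⟨C, η, hC, hC2, h⟩ := exists_sigma_add L hs
  refine ⟨C, η, hC, fun n => ?_⟩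
  induction n with
  | zero => simp
  | succ n ih =>
    intro u
    have e1 : u + ((n + 1 : ℕ) : ℂ) * s = u + n * s + s := by push_cast; ring
    have e2 : Complex.exp (η * (u + n * s)) = Complex.exp (η * u) * (C ^ 2) ^ n := by
      rw [hC2, ← Complex.exp_nat_mul, ← Complex.exp_add]
      congr 1
      ring
    have e3 : Complex.exp (((n + 1 : ℕ) : ℂ) * (η * u)) =
        Complex.exp (n * (η * u)) * Complex.exp (η * u) := by
      rw [← Complex.exp_add]
      congr 1
      push_cast
      ring
    rw [e1, h, ih, e2, e3]
    ring

lemma isElliptic_const_mul_div {F G : ℂ → ℂ} (k : ℂ) (hF : Differentiable ℂ F)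
    (hG : Differentiable ℂ G)
    (h : ∀ s ∈ L.lattice, ∀ t, ∃ m : ℂ, m ≠ 0 ∧ F (t + s) = m * F t ∧ G (t + s) = m * G t) :
    IsElliptic L fun t => k * (F t / G t) := by
  refine ⟨fun t => ?_, fun s hs t => ?_⟩
  · exact (MeromorphicAt.const k t).fun_mul
      ((hF.analyticAt t).meromorphicAt.fun_div (hG.analyticAt t).meromorphicAt)
  · obtain ⟨m, hm, h1, h2⟩ := h s hs t
    dsimp only
    rw [h1, h2, mul_div_mul_left _ _ hm]

lemma isElliptic_ellD (hw : sigma L w ≠ 0) (β γ : ℂ) (n : ℕ) :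
    IsElliptic L (ellD L w β γ n) := by
  have hσ := differentiable_sigma L
  rw [funext (ellD_eq L hw β γ n)]
  refine isElliptic_const_mul_div L _ (by fun_prop) (by fun_prop) fun s hs t => ?_
  obtain ⟨C, η, hC, h⟩ := exists_sigma_add_nat_mul L hs
  -- Numerator and denominator have the same multiplier because their sigma arguments agree in the
  -- sum of squared coefficients of `t` and in the coefficient-weighted sum.
  refine ⟨C ^ (1 + (n + 1) ^ 2 + n ^ 2) * Complex.exp (η * (t - w * n) +
    (n + 1) * (η * (β + (t + w) * (n + 1))) + n * (η * (β + t * n))),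
    mul_ne_zero (pow_ne_zero _ hC) (Complex.exp_ne_zero _), ?_, ?_⟩
  · have e1 : t + s - w * n = t - w * n + (1 : ℕ) * s := by push_cast; ring
    have e2 : β + (t + s + w) * (n + 1) = β + (t + w) * (n + 1) + (n + 1 : ℕ) * s := by
      push_cast; ring
    have e3 : β + (t + s) * n = β + t * n + n * s := by ring
    rw [e1, e2, e3, h, h, h, Complex.exp_add, Complex.exp_add]
    push_cast
    rw [one_mul]
    ring
  · have e1 : t + s + w * (n + 1) = t + w * (n + 1) + (1 : ℕ) * s := by push_cast; ring
    have e2 : β + (t + s + w) * n = β + (t + w) * n + n * s := by ring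
    have e3 : β + (t + s) * (n + 1) = β + t * (n + 1) + (n + 1 : ℕ) * s := by push_cast; ring
    have e4 : η * (t - w * n) + (n + 1) * (η * (β + (t + w) * (n + 1))) + n * (η * (β + t * n)) =
        (1 : ℕ) * (η * (t + w * (n + 1))) + n * (η * (β + (t + w) * n)) +
          (n + 1 : ℕ) * (η * (β + t * (n + 1))) := by push_cast; ring
    rw [e1, e2, e3, h, h, h, e4, Complex.exp_add, Complex.exp_add]
    ring

lemma isElliptic_ellB (hw : sigma L w ≠ 0) (β γ : ℂ) (n : ℕ) :
    IsElliptic L (ellB L w β γ n) := by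
  rcases n with - | n
  · rw [funext (ellB_zero L β γ)]
    exact ⟨fun t => MeromorphicAt.const 0 t, fun s _ t => rfl⟩
  have hσ := differentiable_sigma L
  rw [funext (ellB_succ_eq L hw β γ n)]
  refine isElliptic_const_mul_div L _ (by fun_prop) (by fun_prop) fun s hs t => ?_
  obtain ⟨C, η, hC, h⟩ := exists_sigma_add_nat_mul L hs
  -- The balance here is `(n + 2) ^ 2 + n ^ 2 = 2 * (n + 1) ^ 2 + 2`; the factor `σ(w (n + 1)) ^ 2`
  -- does not involve `t`.
  refine ⟨C ^ ((n + 2) ^ 2 + n ^ 2) * Complex.exp (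
    (n + 2 : ℕ) * (η * (β + (t + w) * (n + 2))) + n * (η * (β + t * n))),
    mul_ne_zero (pow_ne_zero _ hC) (Complex.exp_ne_zero _), ?_, ?_⟩
  · have e2 : β + (t + s + w) * (n + 2) = β + (t + w) * (n + 2) + (n + 2 : ℕ) * s := by
      push_cast; ring
    have e3 : β + (t + s) * n = β + t * n + n * s := by ring
    rw [e2, e3, h, h, Complex.exp_add]
    ring
  · have e1 : β + (t + s + w) * (n + 1) = β + (t + w) * (n + 1) + (n + 1 : ℕ) * s := by
      push_cast; ring
    have e2 : β + (t + s) * (n + 1) = β + t * (n + 1) + (n + 1 : ℕ) * s := by push_cast; ring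
    have e3 : t + s + w * (n + 1) = t + w * (n + 1) + (1 : ℕ) * s := by push_cast; ring
    have e4 : t + s + w * (n + 2) = t + w * (n + 2) + (1 : ℕ) * s := by push_cast; ring
    have e5 : (n + 2 : ℕ) * (η * (β + (t + w) * (n + 2))) + n * (η * (β + t * n)) =
        (n + 1 : ℕ) * (η * (β + (t + w) * (n + 1))) + (n + 1 : ℕ) * (η * (β + t * (n + 1))) +
          (1 : ℕ) * (η * (t + w * (n + 1))) + (1 : ℕ) * (η * (t + w * (n + 2))) := by
      push_cast; ring
    rw [e1, e2, e3, e4, h, h, h, h, e5, Complex.exp_add, Complex.exp_add, Complex.exp_add]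
    ring

end Elliptic

/-! ### Incommensurability and assembly of the theorem -/

/-- In a rectangular lattice a real number incommensurable with the real period has no nonzero
multiple in the lattice. -/
lemma mul_notMem_lattice (L : PeriodPair) (hω₁ : L.ω₁.im = 0) (hω₂ : L.ω₂.re = 0) (w : ℝ)
    (hw : ∀ N₁ N₂ : ℤ, (N₁, N₂) ≠ (0, 0) → (w : ℂ) * N₁ ≠ L.ω₁ / 2 * N₂) (m : ℤ) (hm : m ≠ 0) :
    (w : ℂ) * m ∉ L.lattice := by
  intro h
  obtain ⟨a, b, hab⟩ := PeriodPair.mem_lattice.1 h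
  have him := congr_arg Complex.im hab
  simp [hω₁] at him
  rcases him with hb | hb
  -- The factor `2` appears because `L.ω₁` is the full period, while `hw` is stated with the half
  -- period.
  · refine hw m (2 * a) (by simp [hm]) ?_
    rw [← hab, hb]
    push_cast
    ring
  · have : L.ω₂ = 0 := Complex.ext hω₂ hb
    exact L.indep.ne_zero 1 (by simpa using this)

end EllipticLBP

open Polynomial EllipticLBP in
theorem mainTheorem2 (L : PeriodPair) (hω₁ : L.ω₁.im = 0) (hω₂ : L.ω₂.re = 0)
    (w : ℝ)
    (hw : ∀ N₁ N₂ : ℤ, (N₁, N₂) ≠ (0, 0) → (w : ℂ) * N₁ ≠ L.ω₁ / 2 * N₂)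
    (α β γ : ℂ)
    (hα : ∀ m : ℤ, α + m * w ∉ L.lattice)
    (hβ : β ∉ L.lattice) :
    -- shifts of the moments and nondegeneracy of the Toeplitz determinants
    (∀ (j : ℤ) (n : ℕ),
      toeplitz (ellMoment L w β γ α) j n = toeplitz (ellMoment L w β γ (α + j * w)) 0 n ∧
      (toeplitz (ellMoment L w β γ α) j n ≠ 0 ↔ n * (α + j * w) + β ∉ L.lattice)) ∧
    -- closed forms and recurrence coefficients
    ((∀ n, toeplitz (ellMoment L w β γ α) 0 n ≠ 0) →
      (∀ n, toeplitz (ellMoment L w β γ α) 1 n ≠ 0) →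
      ∀ (c : ℤ → ℂ), c = ellMoment L w β γ α →
      (∀ n, hNorm c 0 n = ellH L w β γ n α) ∧
      (∀ n, hNorm c 1 n = ellH1 L w β γ n α) ∧
      (∀ n, recD c n = ellD L w β γ n α ∧ recD c n ≠ 0 ∧
        recD c n = -((lbp c (n + 1)).eval 0 / (lbp c n).eval 0)) ∧
      (∀ n, recB c n = ellB L w β γ n α) ∧
      (∀ n, recB c (n + 1) ≠ 0) ∧
      (∀ d : ℂ, lbp c 1 + (C d - X) * lbp c 0 = 0 ↔ d = ellD L w β γ 0 α) ∧
      (∀ n, ∀ d b : ℂ,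
        lbp c (n + 2) + (C d - X) * lbp c (n + 1) = X * C b * lbp c n ↔
          d = ellD L w β γ (n + 1) α ∧ b = ellB L w β γ (n + 1) α)) ∧
    -- ellipticity in the time variable
    (∀ n, IsElliptic L (ellD L w β γ n) ∧ IsElliptic L (ellB L w β γ n)) ∧
    -- the `QD`-algorithms
    ((∀ (j : ℤ) (n : ℕ), toeplitz (ellMoment L w β γ α) j n ≠ 0) →
      ∀ b d : ℤ → ℕ → ℂ,
      (∀ j n, b j n = ellB L w β γ n (α + j * w)) →
      (∀ j n, d j n = ellD L w β γ n (α + j * w)) →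
      IsTwoPointQD b d ∧ IsDiscreteRelToda b d ∧
      ∀ e f : ℤ → ℕ → ℂ,
      (∀ j n, e j n = b (j + n) n - d (j + n) n) →
      (∀ j n, f j n = b (j + n - 1) n) →
      IsQD e f ∧
      ∀ W : ℤ → ℕ → ℂ[X],
      (∀ (j : ℤ) (n : ℕ), W j n = lbp (ellMoment L w β γ (α + ((j + n : ℤ) : ℂ) * w)) n) →
      (∀ j n, W (j - 1) (n + 1) = W j (n + 1) - C (f j (n + 1)) * W j n) ∧
      (∀ j n, X * W (j + 1) n = W j (n + 1) - C (e (j + 1) n) * W j n) ∧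
      (∀ j, W j 1 + C (-e j 0 - f j 1) * W j 0 = X * W j 0) ∧
      (∀ j n, W j (n + 2) + C (-e j (n + 1) - f j (n + 2)) * W j (n + 1) +
        C (e j (n + 1) * f j (n + 1)) * W j n = X * W j (n + 1))) := by
  have hw' := mul_notMem_lattice L hω₁ hω₂ w hw
  have hσ := sigma_step_ne_zero L hw'
  have hshift : ∀ (j : ℤ) (n : ℕ), toeplitz (ellMoment L w β γ α) j n =
      toeplitz (ellMoment L w β γ (α + j * w)) 0 n := fun j n => by
    rw [toeplitz_ellMoment_shift, zero_add]
  refine ⟨fun j n => ⟨hshift j n, ?_⟩, fun h0 h1 c hc => ?_,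
    fun n => ⟨isElliptic_ellD L hσ β γ n, isElliptic_ellB L hσ β γ n⟩, fun h b d hb hd => ?_⟩
  · rw [hshift]
    exact toeplitz_ellMoment_ne_zero_iff L γ hw' (shift_notMem_lattice L hα j) hβ n
  · subst hc
    have hD := recD_eq_ellD L γ hw' hα hβ h0
    have hB := recB_eq_ellB L γ hw' hα hβ h0
    refine ⟨hNorm_zero_eq_ellH L γ hw' hα hβ, hNorm_one_eq_ellH1 L γ hw' hα hβ,
      fun n => ⟨hD n, recD_ne_zero h0 h1 n, recD_eq_neg_eval_div h0 h1 n⟩, hB,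
      recB_succ_ne_zero h0 h1, fun d => ?_, fun n d b => ?_⟩
    · rw [← hD, lbp_recurrence_zero_iff h0 h1]
    · rw [← hD, ← hB, lbp_recurrence_iff h0 h1]
  · have h0 : ∀ (j : ℤ) (n : ℕ), toeplitz (ellMoment L w β γ (α + j * w)) 0 n ≠ 0 := fun j n => by
      rw [← hshift]
      exact h j n
    have h1 : ∀ (j : ℤ) (n : ℕ), toeplitz (ellMoment L w β γ (α + j * w)) 1 n ≠ 0 := fun j n => by
      rw [toeplitz_ellMoment_shift]
      exact h _ n
    have hd' : ∀ j n, d j n = recD (ellMoment L w β γ (α + j * w)) n := fun j n => by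
      rw [hd, recD_eq_ellD L γ hw' (shift_notMem_lattice L hα j) hβ (h0 j)]
    have hb' : ∀ j n, b j n = recB (ellMoment L w β γ (α + j * w)) n := fun j n => by
      rw [hb, recB_eq_ellB L γ hw' (shift_notMem_lattice L hα j) hβ (h0 j)]
    let P : ℤ → ℕ → ℂ[X] := fun j n => lbp (ellMoment L w β γ (α + j * w)) n
    -- One time step is an index shift of the moments, so the shift relations of a general sequence
    -- apply at every `j`.
    have hc : ∀ j : ℤ, ellMoment L w β γ (α + (j + 1 : ℤ) * w) =
        fun k => ellMoment L w β γ (α + j * w) (k + 1) := fun j => by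
      rw [← ellMoment_shift]
      congr 1
      push_cast
      ring
    have hP0 : ∀ j, P j 0 = 1 := fun j => lbp_zero _
    have hA : ∀ j n, X * P (j + 1) n = P j (n + 1) + C (d j n) * P j n := fun j n => by
      rw [hd']
      simp only [P, hc]
      exact X_mul_lbp_shift (h0 j) (h1 j) n
    have hB : ∀ j n, P (j + 1) (n + 1) = P j (n + 1) + C (b j (n + 1)) * P j n := fun j n => by
      rw [hb']
      simp only [P, hc]
      exact lbp_shift_succ (h0 j) (h1 j) n
    have hQD : IsTwoPointQD b d := isTwoPointQD_of_relations hP0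
      (fun j n => natDegree_lbp_le _ n) (fun j n => coeff_lbp_self (h0 j n)) hA hB
      (fun j => by rw [hb', recB]) (fun j n => by rw [hd']; exact recD_ne_zero (h0 j) (h1 j) n)
      (fun j n => by rw [hb']; exact recB_succ_ne_zero (h0 j) (h1 j) n)
    exact ⟨hQD, hQD.isDiscreteRelToda, fun e f he hf => ⟨hQD.isQD he hf, fun W hW =>
      staircase_relations hQD hP0 hA hB he hf hW⟩⟩
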